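/- **Setting.** Let $d\ge 1$. A function $f:\mathbb R^d\to\mathbb R$ has $L$-Lipschitz $p$-th derivatives if for all $x$, all $s$ with $\|s\|\le 1$ and all $\theta\in\mathbb R$ the function $q(\theta)=f(x+\theta s)$ satisfies $|q^{(p)}(0)-q^{(p)}(\theta)|\le L|\theta|$. Write $B_R(x)$ for the closed Euclidean ball, $\log^+\theta=\max\{1,\log\theta\}$. *Cutting plane method* for a differentiable $h$, from $x_0$ with radius $R$: for a vector $g$ and a point $c$ let $H(g,c)=\{x: g^T(x-c)\le 0\}$ if $g\ne0$ and $H(0,c)=\{c\}$. Put $S_0=B_R(x_0)\cap H(\nabla h(x_0),x_0)$ and, for $t\ge1$, $x_t=\mathrm{Centre}(S_{t-1})$, $S_t=S_{t-1}\cap H(\nabla h(x_t),x_t)$. *Assumption on Centre* (with parameter $\tau\in(0,1/2]$): Centre is measurable in the data (ball and cuts) describing the region, and for all differentiable $h$, all $x_0$, $R>0$ and $N\ge1$ one has $x_N\in S_{N-1}$ and $\mathrm{vol}(S_N)\le(1-\tau)^N\mathrm{vol}(B_R(0))$. A call of Centre takes time $T_C$. *Trust-region routine* with data $(f,z,\epsilon,L_1,L_3,R)$.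 Put $\alpha=21L_3R^2$, $\hat f(x)=f(x)+\frac\alpha2\|z-x\|^2$, $\hat\epsilon=\epsilon/2$, $\hat L_1=L_1+\alpha$, $N=\lceil\frac d\tau\log(16\hat L_1R/\hat\epsilon)\rceil$, and run $N$ steps of the cutting plane method on $\hat f$ from $x_0=z$ with radius $R$. Let $x_{\rm best}$ be the first minimizer of $\hat f$ among $x_0,\dots,x_N$. If $\|\nabla\hat f(x_{\rm best})\|\le\hat\epsilon$, set $u=x_{\rm best}$, $v=\emptyset$. Otherwise draw independent uniform points of the ball of radius $\hat\epsilon/(8\hat L_1)$ around $x_{\rm best}-\nabla\hat f(x_{\rm best})/\hat L_1$ until a point $u\notin S_N$ is drawn; if $\|u-x_0\|\le R$, let $v$ be the first $x_t$ with $\hat f(u)<\hat f(x_t)+\nabla\hat f(x_t)^T(u-x_t)$, and otherwise $v=\emptyset$. For a point $c$ and a unit vector $s$ let $\mathrm{Exploit}(c,s)=c+\theta_*s$, where $\theta_*$ minimizes $f(c+\theta s)$ over $\theta\in\{12R,9R,-9R,-12R\}$. If $\|\nabla f(u)\|\le\epsilon$, let $p$ be a unit vector minimizing $s^T\nabla^2f(u)s$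 (computed by a singular value decomposition, measurably in the matrix); return $u$ if $p^T\nabla^2f(u)p\ge-\alpha$ and $\mathrm{Exploit}(u,p)$ otherwise. If $\|\nabla f(u)\|>\epsilon$, return $u$ if $v=\emptyset$ and $\mathrm{Exploit}\big(\frac{u+v}2,\frac{v-u}{\|u-v\|}\big)$ otherwise. *Procedure.* Given $z^{(t)}$, let $\bar f^{(t)}$ be the third-order Taylor polynomial of $f$ at $z^{(t)}$ plus $\frac{2L_3}{4!}\|x-z^{(t)}\|^4$, and let $z^{(t+1)}$ be the output of the trust-region routine (with fresh independent random points) for the data $(\bar f^{(t)},z^{(t)},\epsilon/2,2L_1,2L_3,\;L_3^{-1/3}\epsilon^{1/3}/24)$. *Time.* Evaluating $f$ and its first three derivatives at a point takes time $T_3\ge 0$ and is done once per iterate; a call of Centre takes $T_C\ge 0$; an operation on vectors of length $d$ (linear combination, inner product, test of a point against one half-space or ball, random draw from a ball) takes $\kappa d$; an evaluation of $\bar f^{(t)}$ with its gradient and Hessian, and a singular value decomposition, take $\kappa d^3$ each. **Theorem.** For every $\kappa>0$ there is a constant $C>0$, depending only on $\kappa$, such that the following holds. Suppose the assumption on Centre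 holds. Let $L_1,L_3\in(0,\infty)$, $\epsilon\in(0,L_1^{3/2}/L_3^{1/2}]$, and let $f:\mathbb R^d\to\mathbb R$ be $C^3$ and bounded below, with $L_1$-Lipschitz first derivatives and $L_3$-Lipschitz third derivatives. Let $z^{(0)}\in\mathbb R^d$ and $f(z^{(0)})-\inf f\le\Delta$. Then there is a positive random variable $\bar K$ with $\mathbf P(\bar K\ge y)\le e^{(1-y)/10}$ for all $y\in\mathbb R$ such that, almost surely, the procedure reaches a point $z^{(m)}$ with $$\|\nabla f(z^{(m)})\|\le\epsilon,\qquad \lambda_{\min}(\nabla^2f(z^{(m)}))\ge-L_3^{1/3}\epsilon^{2/3},$$ and the total time, including an evaluation of $f$ and its derivatives at $z^{(m)}$, is at most $$C\,\big(\Delta L_3^{1/3}\epsilon^{-4/3}+1\big)\Big(T_3+\frac{(T_C+d^3+\bar Kd)\,d}{\tau}\log^+\!\Big(\frac{L_1^3}{\epsilon^2L_3}\Big)\Big).$$ -/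

import Mathlib

noncomputable section

/-- Euclidean space of dimension `d`. -/
abbrev Vec (d : ℕ) : Type := EuclideanSpace ℝ (Fin d)

/-! ### Smoothness -/

/-- `f` has `L`-Lipschitz `p`-th derivatives on `Q`: along every line `q(θ) = f (x + θ s)` with
`‖s‖ ≤ 1`, one has `|q⁽ᵖ⁾(0) - q⁽ᵖ⁾(θ)| ≤ L |θ|` as long as both points lie in `Q`. -/
def HasLipschitzDerivs {d : ℕ} (p : ℕ) (L : ℝ) (f : Vec d → ℝ) (Q : Set (Vec d)) : Prop :=
  ∀ x ∈ Q, ∀ s ∈ Metric.closedBall (0 : Vec d) 1, ∀ θ : ℝ, x + θ • s ∈ Q →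
    |iteratedDeriv p (fun t : ℝ => f (x + t • s)) 0
      - iteratedDeriv p (fun t : ℝ => f (x + t • s)) θ| ≤ L * |θ|

/-- The Hessian matrix of `f` at `x`. -/
def hessian {d : ℕ} (f : Vec d → ℝ) (x : Vec d) : Matrix (Fin d) (Fin d) ℝ :=
  Matrix.of fun i j =>
    iteratedFDeriv ℝ 2 f x ![EuclideanSpace.single i 1, EuclideanSpace.single j 1]

/-- The smallest (real) eigenvalue of a matrix. -/
def lambdaMin {d : ℕ} (A : Matrix (Fin d) (Fin d) ℝ) : ℝ := sInf (spectrum ℝ A)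

/-- The quadratic form `sᵀ A s`. -/
def quadForm {d : ℕ} (A : Matrix (Fin d) (Fin d) ℝ) (s : Vec d) : ℝ :=
  (fun i => s i) ⬝ᵥ A.mulVec (fun i => s i)

/-- The regularized `p`-th order Taylor model of `f` at `z`:
`∑_{k ≤ p} Dᵏf(z)[x - z]ᵏ / k! + 2 L / (p + 1)! ‖x - z‖ᵖ⁺¹`. -/
def taylorModel {d : ℕ} (p : ℕ) (L : ℝ) (f : Vec d → ℝ) (z x : Vec d) : ℝ :=
  (∑ k ∈ Finset.range (p + 1),
      (iteratedFDeriv ℝ k f z fun _ => x - z) / (Nat.factorial k : ℝ))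
    + 2 * L / (Nat.factorial (p + 1) : ℝ) * ‖x - z‖ ^ (p + 1)

/-! ### The cutting plane method -/

/-- The part kept by a cut through `c` with normal `g`: the half-space `gᵀ (x - c) ≤ 0`.
If `g = 0` the inequality cuts off nothing; then only the stationary point `c` is kept. -/
def cut {d : ℕ} (g c : Vec d) : Set (Vec d) :=
  {x | inner ℝ g (x - c) ≤ 0 ∧ (g = 0 → x = c)}

/-- The cutting plane method for `h` started at `x₀` with radius `R`: after `t` steps, the pair
of the region `Sₜ` and the query point `xₜ`, where `xₜ₊₁ = centre Sₜ`. -/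
def cuttingPlane {d : ℕ} (centre : Set (Vec d) → Vec d) (h : Vec d → ℝ) (x₀ : Vec d) (R : ℝ) :
    ℕ → Set (Vec d) × Vec d
  | 0 => (Metric.closedBall x₀ R ∩ cut (gradient h x₀) x₀, x₀)
  | t + 1 =>
    let S := (cuttingPlane centre h x₀ R t).1
    let c := centre S
    (S ∩ cut (gradient h c) c, c)

/-- The assumption on the routine `centre`: it selects a point of the current region, and on
every differentiable function the volume of the region after `N` steps is at most `(1 - τ)ᴺ`
times the volume of the initial ball.  `centre` is a measurable function of the data (centre of
the ball, base points and normals of the cuts) that describe the region. -/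
structure IsCuttingPlaneCentre {d : ℕ} (centre : Set (Vec d) → Vec d) (τ : ℝ) : Prop where
  tau_pos : 0 < τ
  tau_le : τ ≤ 1 / 2
  mem : ∀ (h : Vec d → ℝ), Differentiable ℝ h → ∀ (x₀ : Vec d) (R : ℝ), 0 < R → ∀ t : ℕ,
    (cuttingPlane centre h x₀ R (t + 1)).2 ∈ (cuttingPlane centre h x₀ R t).1
  volume_le : ∀ (h : Vec d → ℝ), Differentiable ℝ h → ∀ (x₀ : Vec d) (R : ℝ), 0 < R →
    ∀ N : ℕ, 0 < N →
      MeasureTheory.volume (cuttingPlane centre h x₀ R N).1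
        ≤ ENNReal.ofReal ((1 - τ) ^ N) * MeasureTheory.volume (Metric.closedBall (0 : Vec d) R)
  measurable : ∀ (n : ℕ) (R : ℝ), 0 < R →
    Measurable fun q : Vec d × (Fin (n + 1) → Vec d × Vec d) =>
      centre (Metric.closedBall q.1 R ∩ ⋂ i, cut (q.2 i).2 (q.2 i).1)

/-- The routine `svd` returns, for a symmetric matrix `A`, a minimizer of `sᵀ A s` over the
unit sphere, in a measurable way. -/
structure IsMinDirection {d : ℕ} (svd : Matrix (Fin d) (Fin d) ℝ → Vec d) : Prop where
  measurable : Measurable fun A : Fin d → Fin d → ℝ => svd (Matrix.of A)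
  norm_eq : ∀ A : Matrix (Fin d) (Fin d) ℝ, A.IsSymm → ‖svd A‖ = 1
  isMin : ∀ A : Matrix (Fin d) (Fin d) ℝ, A.IsSymm → ∀ s : Vec d, ‖s‖ = 1 →
    quadForm A (svd A) ≤ quadForm A s

/-! ### Computations with a clock -/

/-- A computation either diverges (`none`) or returns a value together with the time used. -/
def Comp (α : Type) : Type := Option (α × ℝ)

/-- Sequential composition adds the times. -/
instance : Monad Comp where
  pure a := some (a, 0)
  bind x g := Option.bind x fun p => Option.bind (g p.1) fun q => some (q.1, p.2 + q.2)

/-- The computation `x` terminates and returns `a` after time `t`. -/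
def Comp.Returns {α : Type} (x : Comp α) (a : α) (t : ℝ) : Prop := x = some (a, t)

/-- Spend time `c`. -/
def tick (c : ℝ) : Comp Unit := some ((), c)

/-- The times of the primitive operations: one call of `centre`; one evaluation of the objective
with its gradient and Hessian; one singular value decomposition of a `d × d` matrix (with the
evaluation of a quadratic form); one operation on vectors of length `d` (linear combination,
inner product, test of a point against one half-space or a ball, drawing a uniform point of a
ball, ...). -/
structure Costs where
  centre : ℝ
  eval : ℝ
  svd : ℝ
  vec : ℝ

/-- The first minimizer of `φ` in the list `a :: l`. -/
def argminFirst {α : Type} (φ : α → ℝ) (a : α) (l : List α) : α :=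
  open Classical in l.foldl (fun b x => if φ x < φ b then x else b) a

/-- Draw `y + r • U 0`, `y + r • U 1`, ... until a point is outside `S`; returns that point and
the number of draws.  Each draw costs `c`.  Diverges if every point is in `S`. -/
def sampleOutside {d : ℕ} (c : ℝ) (S : Set (Vec d)) (y : Vec d) (r : ℝ) (U : ℕ → Vec d) :
    Comp (Vec d × ℕ) :=
  open Classical in
  if h : ∃ k, y + r • U k ∉ S then
    some ((y + r • U (Nat.find h), Nat.find h + 1), ((Nat.find h + 1 : ℕ) : ℝ) * c)
  else none

/-- The search for a certificate of nonconvexity of `h` after `N` steps of the cutting plane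
method with regions and points `run`; `U` is a stream of points of the unit ball, so that
`y + r • U k` is a point of the ball of radius `r` around `y`.  Returns `u`, `v` (`none` for
"no point") and the number `K` of draws. -/
def nonconvexityCertificate {d : ℕ} (T : Costs) (h : Vec d → ℝ) (N : ℕ)
    (run : ℕ → Set (Vec d) × Vec d) (L ε R : ℝ) (U : ℕ → Vec d) :
    Comp (Vec d × Option (Vec d) × ℕ) :=
  open Classical in do
  let x := fun t => (run t).2
  let S := (run N).1
  tick ((N + 1) * T.vec)
  let xbest := argminFirst h (x 0) ((List.range N).map fun t => x (t + 1))
  tick T.vec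
  if ‖gradient h xbest‖ ≤ ε then
    return (xbest, none, 0)
  else
    tick T.vec
    let y := xbest - (1 / L) • gradient h xbest
    let r := ε / (8 * L)
    -- one draw, then the ball and the `N + 1` half-spaces that make up `S`
    let (u, K) ← sampleOutside (T.vec + (N + 2) * T.vec) S y r U
    tick T.vec
    if ‖u - x 0‖ ≤ R then
      tick (T.eval + T.vec + (N + 1) * T.vec)
      let v := ((List.range (N + 1)).map x).find?
        fun v => decide (h u < h v + inner ℝ (gradient h v) (u - v))
      return (u, v, K)
    else
      return (u, none, K)

/-- Exploiting a direction `s` of negative curvature of `f` near `c`. -/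
def exploitNC {d : ℕ} (T : Costs) (f : Vec d → ℝ) (c s : Vec d) (R : ℝ) : Comp (Vec d) := do
  tick (4 * (T.eval + T.vec))
  let θ := argminFirst (fun θ : ℝ => f (c + θ • s)) (12 * R) [9 * R, -9 * R, -12 * R]
  return c + θ • s

/-- The cutting plane trust-region routine: returns the new point and the number of draws. -/
def cuttingTrustRegion {d : ℕ} (T : Costs) (centre : Set (Vec d) → Vec d) (τ : ℝ)
    (svd : Matrix (Fin d) (Fin d) ℝ → Vec d) (f : Vec d → ℝ) (z : Vec d) (ε L₁ L₃ R : ℝ)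
    (U : ℕ → Vec d) : Comp (Vec d × ℕ) :=
  open Classical in do
  let α := 21 * L₃ * R ^ 2
  let fhat := fun x => f x + α / 2 * ‖z - x‖ ^ 2
  let εhat := ε / 2
  let Lhat := L₁ + α
  let N := ⌈(d : ℝ) / τ * Real.log (16 * Lhat * R / εhat)⌉₊
  -- the cutting plane method: `N + 1` evaluations and `N` centres
  tick ((T.eval + T.vec) + N * (T.centre + T.eval + T.vec))
  let (u, v, K) ← nonconvexityCertificate T fhat N (cuttingPlane centre fhat z R) Lhat εhat R U
  tick (T.eval + T.vec)
  if ‖gradient f u‖ ≤ ε then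
    tick T.svd
    let p := svd (hessian f u)
    if -α ≤ quadForm (hessian f u) p then
      return (u, K)
    else
      let z' ← exploitNC T f u p R
      return (z', K)
  else
    match v with
    | none => return (u, K)
    | some v =>
      let z' ← exploitNC T f ((1 / 2 : ℝ) • (u + v)) ((1 / ‖u - v‖) • (v - u)) R
      return (z', K)

/-- The iterates `z_t` of the cutting plane method on quartic regularized models, together with
the time spent on computing them.  In pass `t` the function `f` and its first three derivatives
are evaluated once, at `z_t` (time `T₃`); then the trust-region routine is run on the regularized
third order model, with the stream `U t` of random points.  An evaluation of the model, with its
gradient and Hessian, and a singular value decomposition take time `κ d³` each, a vector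
operation takes time `κ d`, and a call of `centre` takes time `TC`. -/
def quarticIterates {d : ℕ} (κ T₃ TC : ℝ) (centre : Set (Vec d) → Vec d) (τ : ℝ)
    (svd : Matrix (Fin d) (Fin d) ℝ → Vec d) (f : Vec d → ℝ) (z₀ : Vec d) (ε L₁ L₃ : ℝ)
    (U : ℕ → ℕ → Vec d) : ℕ → Comp (Vec d)
  | 0 => pure z₀
  | t + 1 => do
    let z ← quarticIterates κ T₃ TC centre τ svd f z₀ ε L₁ L₃ U t
    tick T₃
    let T : Costs :=
      { centre := TC, eval := κ * (d : ℝ) ^ 3, svd := κ * (d : ℝ) ^ 3, vec := κ * (d : ℝ) }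
    let (z', _) ← cuttingTrustRegion T centre τ svd (taylorModel 3 L₃ f z) z
      (ε / 2) (2 * L₁) (2 * L₃) (L₃ ^ (-(1 / 3) : ℝ) * ε ^ (1 / 3 : ℝ) / 24) (U t)
    return z'

/-- `log⁺ θ = max {1, log θ}`. -/
def logPlus (θ : ℝ) : ℝ := max 1 (Real.log θ)

/-- `(Δ L₃^{1/3} ε^{-4/3} + 1) (T₃ + (TC + d³ + K d) d / τ · log⁺(L₁³ / (ε² L₃)))`. -/
def timeBound (d : ℕ) (T₃ TC τ L₁ L₃ ε Δ K : ℝ) : ℝ :=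
  (Δ * L₃ ^ (1 / 3 : ℝ) * ε ^ (-(4 / 3) : ℝ) + 1) *
    (T₃ + (TC + (d : ℝ) ^ 3 + K * d) * d / τ * logPlus (L₁ ^ 3 / (ε ^ 2 * L₃)))

end

section

open scoped ContDiff

/-! ### Restrictions to lines -/

theorem iteratedDeriv_line {d k : ℕ} {n : WithTop ℕ∞} {f : Vec d → ℝ} (hf : ContDiff ℝ n f)
    (hk : (k : WithTop ℕ∞) ≤ n) (x s : Vec d) (t : ℝ) :
    iteratedDeriv k (fun t : ℝ => f (x + t • s)) t
      = iteratedFDeriv ℝ k f (x + t • s) fun _ => s := by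
  have h1 : (fun t : ℝ => f (x + t • s))
      = (fun y => f (x + y)) ∘ (ContinuousLinearMap.toSpanSingleton ℝ s) := by
    ext t; simp [ContinuousLinearMap.toSpanSingleton_apply]
  have h2 : ContDiff ℝ n (fun y => f (x + y)) := by fun_prop
  rw [iteratedDeriv_eq_iteratedFDeriv, h1,
    ContinuousLinearMap.iteratedFDeriv_comp_right _ h2 t hk, iteratedFDeriv_comp_add_left]
  simp [ContinuousLinearMap.toSpanSingleton_apply]

theorem hasDerivAt_line {d : ℕ} {f : Vec d → ℝ} (hf : Differentiable ℝ f) (x s : Vec d) (t : ℝ) :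
    HasDerivAt (fun t : ℝ => f (x + t • s)) (inner ℝ (gradient f (x + t • s)) s) t := by
  have h1 : HasDerivAt (fun t : ℝ => x + t • s) s t := by
    simpa using ((hasDerivAt_id t).smul_const s).const_add x
  have h2 := (hf (x + t • s)).hasGradientAt.hasFDerivAt.comp_hasDerivAt t h1
  exact h2

theorem quadForm_hessian {d : ℕ} (f : Vec d → ℝ) (x s : Vec d) :
    quadForm (hessian f x) s = iteratedFDeriv ℝ 2 f x fun _ => s := by
  have hs : s = ∑ i, s i • EuclideanSpace.single i (1 : ℝ) := by
    have := (EuclideanSpace.basisFun (Fin d) ℝ).sum_repr s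
    simpa using this.symm
  rw [iteratedFDeriv_two_apply]
  conv_rhs => rw [hs]
  simp only [map_sum, map_smul, sum_apply, smul_apply,
    quadForm, dotProduct, Matrix.mulVec, hessian, Matrix.of_apply, iteratedFDeriv_two_apply,
    smul_eq_mul, Matrix.cons_val_zero, Matrix.cons_val_one, Finset.mul_sum]
  rw [Finset.sum_comm]
  exact Finset.sum_congr rfl fun i _ => Finset.sum_congr rfl fun j _ => by ring

theorem iteratedDeriv_one_line {d : ℕ} {f : Vec d → ℝ} (hf : Differentiable ℝ f) (x s : Vec d)
    (t : ℝ) :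
    iteratedDeriv 1 (fun t : ℝ => f (x + t • s)) t = inner ℝ (gradient f (x + t • s)) s := by
  rw [iteratedDeriv_one]; exact (hasDerivAt_line hf x s t).deriv

theorem iteratedFDeriv_one_const {d : ℕ} {f : Vec d → ℝ} (hf : ContDiff ℝ 1 f) (x s : Vec d) :
    (iteratedFDeriv ℝ 1 f x fun _ => s) = inner ℝ (gradient f x) s := by
  have h := iteratedDeriv_line hf (k := 1) (by simp) x s 0
  rw [iteratedDeriv_one_line (hf.differentiable (by simp))] at h
  rw [zero_smul, add_zero] at h
  exact h.symm

/-! ### One-dimensional Taylor bounds -/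

theorem nonneg_of_hasDerivAt_nonneg {g g' : ℝ → ℝ} (hg : ∀ t, HasDerivAt g (g' t) t)
    (h0 : 0 ≤ g 0) (h : ∀ t, 0 ≤ t → 0 ≤ g' t) (t : ℝ) (ht : 0 ≤ t) : 0 ≤ g t := by
  have hm : MonotoneOn g (Set.Ici 0) := by
    refine monotoneOn_of_deriv_nonneg (convex_Ici 0)
      (fun t _ => (hg t).continuousAt.continuousWithinAt)
      (fun t _ => (hg t).differentiableAt.differentiableWithinAt) fun t ht => ?_
    rw [interior_Ici] at ht
    rw [(hg t).deriv]; exact h t ht.le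
  exact h0.trans (hm (by simp) ht ht)

theorem taylor_three_le {q₀ q₁ q₂ q₃ : ℝ → ℝ} {L : ℝ} (h₀ : ∀ t, HasDerivAt q₀ (q₁ t) t)
    (h₁ : ∀ t, HasDerivAt q₁ (q₂ t) t) (h₂ : ∀ t, HasDerivAt q₂ (q₃ t) t)
    (h : ∀ t, 0 ≤ t → q₃ t ≤ q₃ 0 + L * t) (t : ℝ) (ht : 0 ≤ t) :
    q₀ t ≤ q₀ 0 + q₁ 0 * t + q₂ 0 / 2 * t ^ 2 + q₃ 0 / 6 * t ^ 3 + L / 24 * t ^ 4 := by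
  have hp (a : ℝ) (n : ℕ) (t : ℝ) : HasDerivAt (fun t : ℝ => a * t ^ (n + 1))
      (a * ((n + 1 : ℕ) * t ^ n)) t := by
    simpa using (hasDerivAt_pow (n + 1) t).const_mul a
  have hc (a : ℝ) (t : ℝ) : HasDerivAt (fun _ : ℝ => a) 0 t := hasDerivAt_const t a
  have e2 : ∀ t, 0 ≤ t → 0 ≤ (q₂ 0 + q₃ 0 * t ^ 1 + L / 2 * t ^ 2) - q₂ t := by
    refine nonneg_of_hasDerivAt_nonneg
      (fun t => (((hc _ t).add (hp _ 0 t)).add (hp _ 1 t)).sub (h₂ t)) (by simp) fun t ht => ?_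
    have := h t ht
    push_cast; nlinarith
  have e1 : ∀ t, 0 ≤ t → 0 ≤ (q₁ 0 + q₂ 0 * t ^ 1 + q₃ 0 / 2 * t ^ 2 + L / 6 * t ^ 3) - q₁ t := by
    refine nonneg_of_hasDerivAt_nonneg
      (fun t => ((((hc _ t).add (hp _ 0 t)).add (hp _ 1 t)).add (hp _ 2 t)).sub (h₁ t))
      (by simp) fun t ht => ?_
    have := e2 t ht
    push_cast; nlinarith
  have e0 : ∀ t, 0 ≤ t → 0 ≤ (q₀ 0 + q₁ 0 * t ^ 1 + q₂ 0 / 2 * t ^ 2 + q₃ 0 / 6 * t ^ 3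
      + L / 24 * t ^ 4) - q₀ t := by
    refine nonneg_of_hasDerivAt_nonneg
      (fun t => (((((hc _ t).add (hp _ 0 t)).add (hp _ 1 t)).add (hp _ 2 t)).add
        (hp _ 3 t)).sub (h₀ t)) (by simp) fun t ht => ?_
    have := e1 t ht
    push_cast; nlinarith
  have := e0 t ht
  rw [pow_one] at this
  linarith

theorem abs_sub_taylor_three_le {q₀ q₁ q₂ q₃ : ℝ → ℝ} {L : ℝ}
    (h₀ : ∀ t, HasDerivAt q₀ (q₁ t) t) (h₁ : ∀ t, HasDerivAt q₁ (q₂ t) t)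
    (h₂ : ∀ t, HasDerivAt q₂ (q₃ t) t) (h : ∀ t, 0 ≤ t → |q₃ 0 - q₃ t| ≤ L * |t|) (t : ℝ)
    (ht : 0 ≤ t) :
    |q₀ t - (q₀ 0 + q₁ 0 * t + q₂ 0 / 2 * t ^ 2 + q₃ 0 / 6 * t ^ 3)| ≤ L / 24 * t ^ 4 := by
  have a := taylor_three_le h₀ h₁ h₂ (L := L) (fun t ht => by
    have := abs_le.1 (h t ht); rw [abs_of_nonneg ht] at this; linarith) t ht
  have b := taylor_three_le (fun t => (h₀ t).neg) (fun t => (h₁ t).neg) (fun t => (h₂ t).neg)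
    (L := L) (fun t ht => by
    have := abs_le.1 (h t ht); rw [abs_of_nonneg ht] at this
    linarith) t ht
  simp only [Pi.neg_apply] at b
  rw [abs_le]; constructor <;> linarith

/-! ### Taylor bounds from Lipschitz derivatives along lines -/

theorem hasDerivAt_iteratedDeriv {q : ℝ → ℝ} {n : ℕ} (hq : ContDiff ℝ n q) (k : ℕ) (hk : k < n)
    (t : ℝ) : HasDerivAt (iteratedDeriv k q) (iteratedDeriv (k + 1) q t) t := by
  rw [iteratedDeriv_succ]
  exact (hq.differentiable_iteratedDeriv k (by exact_mod_cast hk) t).hasDerivAt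

theorem exists_unit_smul {d : ℕ} (s : Vec d) :
    ∃ e ∈ Metric.closedBall (0 : Vec d) 1, s = ‖s‖ • e := by
  by_cases h : s = 0
  · exact ⟨0, by simp, by simp [h]⟩
  · refine ⟨‖s‖⁻¹ • s, ?_, ?_⟩
    · have : ‖s‖ ≠ 0 := norm_ne_zero_iff.2 h
      simp [norm_smul, inv_mul_cancel₀ this]
    · rw [smul_smul, mul_inv_cancel₀ (norm_ne_zero_iff.2 h), one_smul]

theorem abs_sub_taylor_le {d : ℕ} {f : Vec d → ℝ} {L : ℝ} (hf : ContDiff ℝ 3 f)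
    (hL : HasLipschitzDerivs 3 L f Set.univ) (x s : Vec d) :
    |f (x + s) - ∑ k ∈ Finset.range 4, (iteratedFDeriv ℝ k f x fun _ => s) / (k.factorial : ℝ)|
      ≤ L / 24 * ‖s‖ ^ 4 := by
  obtain ⟨e, he, hs⟩ := exists_unit_smul s
  have hq : ContDiff ℝ (3 : ℕ) (fun t : ℝ => f (x + t • e)) := by
    have : ContDiff ℝ (3 : ℕ) f := by exact_mod_cast hf
    fun_prop
  have key := abs_sub_taylor_three_le (L := L)
    (fun t => by simpa only [iteratedDeriv_zero] using hasDerivAt_iteratedDeriv hq 0 (by norm_num) t)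
    (hasDerivAt_iteratedDeriv hq 1 (by norm_num)) (hasDerivAt_iteratedDeriv hq 2 (by norm_num))
    (fun t _ => hL x (Set.mem_univ _) e he t (Set.mem_univ _)) ‖s‖ (norm_nonneg s)
  have hc (k : ℕ) (hk : (k : WithTop ℕ∞) ≤ 3) : (iteratedFDeriv ℝ k f x fun _ => s)
      = ‖s‖ ^ k * iteratedDeriv k (fun t : ℝ => f (x + t • e)) 0 := by
    rw [iteratedDeriv_line hf hk, zero_smul, add_zero]
    conv_lhs => rw [hs]
    rw [ContinuousMultilinearMap.map_smul_univ]
    simp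
  simp only [Finset.sum_range_succ, Finset.sum_range_zero]
  rw [hc 0 (by simp), hc 1 (by simp), hc 2 (by norm_cast), hc 3 (by norm_cast)]
  simp only [← hs] at key
  refine le_trans (le_of_eq ?_) key
  simp [Nat.factorial, -iteratedDeriv_one]
  congr 1
  ring

theorem quadForm_hessian_le {d : ℕ} {f : Vec d → ℝ} {L : ℝ} (hL0 : 0 ≤ L) (hf : ContDiff ℝ 3 f)
    (hL : HasLipschitzDerivs 1 L f Set.univ) (x s : Vec d) :
    quadForm (hessian f x) s ≤ L * ‖s‖ ^ 2 := by
  obtain ⟨e, he, hs⟩ := exists_unit_smul s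
  have hq : ContDiff ℝ (3 : ℕ) (fun t : ℝ => f (x + t • e)) := by
    have : ContDiff ℝ (3 : ℕ) f := by exact_mod_cast hf
    fun_prop
  have h := (hasDerivAt_iteratedDeriv hq 1 (by norm_num) 0).le_of_lip' hL0
    (Filter.Eventually.of_forall fun t => by
      have := hL x (Set.mem_univ _) e he t (Set.mem_univ _)
      rw [abs_sub_comm] at this
      rwa [Real.norm_eq_abs, Real.norm_eq_abs, sub_zero])
  have hk : ((1 + 1 : ℕ) : WithTop ℕ∞) ≤ 3 := by norm_cast
  rw [iteratedDeriv_line hf hk, zero_smul, add_zero] at h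
  rw [quadForm_hessian]
  conv_lhs => rw [hs]
  rw [ContinuousMultilinearMap.map_smul_univ]
  simp only [Finset.prod_const, Finset.card_univ, Fintype.card_fin, smul_eq_mul]
  rw [mul_comm]
  exact mul_le_mul_of_nonneg_right ((le_abs_self _).trans h) (by positivity)

theorem le_quadratic_of_hasLipschitzDerivs {d : ℕ} {f : Vec d → ℝ} {L : ℝ} (hf : ContDiff ℝ 3 f)
    (hL : HasLipschitzDerivs 1 L f Set.univ) (x s : Vec d) :
    f (x + s) ≤ f x + inner ℝ (gradient f x) s + L / 2 * ‖s‖ ^ 2 := by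
  obtain ⟨e, he, hs⟩ := exists_unit_smul s
  have hd := hf.differentiable (by simp)
  have h := nonneg_of_hasDerivAt_nonneg (g := fun t => (f x + inner ℝ (gradient f x) e * t
      + L / 2 * t ^ 2) - f (x + t • e)) (g' := fun t => (inner ℝ (gradient f x) e
      + L * t) - inner ℝ (gradient f (x + t • e)) e) (fun t => ?_) (by simp) (fun t ht => ?_)
      ‖s‖ (norm_nonneg s)
  · simp only [← hs] at h
    have : inner ℝ (gradient f x) s = inner ℝ (gradient f x) e * ‖s‖ := by
      conv_lhs => rw [hs]
      rw [inner_smul_right]; ring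
    linarith
  · refine HasDerivAt.sub ?_ (hasDerivAt_line hd x e t)
    have h1 := ((hasDerivAt_id t).const_mul (inner ℝ (gradient f x) e)).const_add (f x)
    have h2 := (hasDerivAt_pow 2 t).const_mul (L / 2)
    refine (h1.add h2).congr_deriv ?_
    simp only [mul_one]; push_cast; ring
  · have := hL x (Set.mem_univ _) e he t (Set.mem_univ _)
    rw [iteratedDeriv_one_line hd, iteratedDeriv_one_line hd, abs_of_nonneg ht] at this
    have := (abs_le.1 this).1
    rw [zero_smul, add_zero] at this
    linarith

end

section

open scoped ContDiff

/-! ### Functions that are quartic polynomials on lines -/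

/-- `F` is smooth and restricts to a quartic polynomial on every line, with leading coefficient
`c ‖s‖⁴` in direction `s`. -/
structure QuarticOnLines {d : ℕ} (c : ℝ) (F : Vec d → ℝ) : Prop where
  contDiff : ContDiff ℝ 3 F
  exists_coeff : ∀ x s, ∃ b₀ b₁ b₂ b₃ : ℝ, ∀ t : ℝ,
    F (x + t • s) = b₀ + b₁ * t + b₂ * t ^ 2 + b₃ * t ^ 3 + c * ‖s‖ ^ 4 * t ^ 4

theorem QuarticOnLines.exists_expansion {d : ℕ} {c : ℝ} {F : Vec d → ℝ} (hF : QuarticOnLines c F)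
    (x s : Vec d) : ∃ b : ℝ, ∀ t : ℝ, F (x + t • s) = F x + inner ℝ (gradient F x) s * t
      + quadForm (hessian F x) s / 2 * t ^ 2 + b * t ^ 3 + c * ‖s‖ ^ 4 * t ^ 4 := by
  obtain ⟨b₀, b₁, b₂, b₃, h⟩ := hF.exists_coeff x s
  set b₄ := c * ‖s‖ ^ 4
  have hp (a : ℝ) (n : ℕ) (t : ℝ) : HasDerivAt (fun t : ℝ => a * t ^ (n + 1))
      (a * ((n + 1 : ℕ) * t ^ n)) t := by
    simpa using (hasDerivAt_pow (n + 1) t).const_mul a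
  have hc (a : ℝ) (t : ℝ) : HasDerivAt (fun _ : ℝ => a) 0 t := hasDerivAt_const t a
  have hfun : (fun t : ℝ => F (x + t • s)) = fun t => b₀ + b₁ * t ^ 1 + b₂ * t ^ 2
      + b₃ * t ^ 3 + b₄ * t ^ 4 := by
    funext t; rw [h t, pow_one]
  have h1 (t : ℝ) : HasDerivAt (fun t : ℝ => F (x + t • s))
      (b₁ + 2 * b₂ * t ^ 1 + 3 * b₃ * t ^ 2 + 4 * b₄ * t ^ 3) t := by
    rw [hfun]
    refine (((((hc _ t).add (hp _ 0 t)).add (hp _ 1 t)).add (hp _ 2 t)).add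
        (hp _ 3 t)).congr_deriv ?_
    push_cast; ring
  have h2 : HasDerivAt (fun t : ℝ => b₁ + 2 * b₂ * t ^ 1 + 3 * b₃ * t ^ 2 + 4 * b₄ * t ^ 3)
      (2 * b₂) 0 := by
    refine ((((hc _ 0).add (hp _ 0 0)).add (hp _ 1 0)).add (hp _ 2 0)).congr_deriv ?_
    push_cast; ring
  have e0 : b₀ = F x := by simpa using (h 0).symm
  have e1 : b₁ = inner ℝ (gradient F x) s := by
    have := (h1 0).unique (hasDerivAt_line (hF.contDiff.differentiable (by simp)) x s 0)
    rw [zero_smul, add_zero] at this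
    rw [← this]; ring
  have e2 : quadForm (hessian F x) s = 2 * b₂ := by
    have := iteratedDeriv_line hF.contDiff (k := 2) (by norm_cast) x s 0
    rw [zero_smul, add_zero] at this
    rw [quadForm_hessian, ← this, iteratedDeriv_succ, iteratedDeriv_one,
      show deriv (fun t : ℝ => F (x + t • s)) = _ from funext fun t => (h1 t).deriv, h2.deriv]
  refine ⟨b₃, fun t => ?_⟩
  rw [h t, e0, e1, e2]; ring

theorem ContinuousMultilinearMap.exists_polynomial_line {d k : ℕ}
    (A : ContinuousMultilinearMap ℝ (fun _ : Fin k => Vec d) ℝ) (a s : Vec d) :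
    ∃ p : Polynomial ℝ, p.natDegree ≤ k ∧ ∀ t : ℝ, (A fun _ => a + t • s) = p.eval t := by
  classical
  refine ⟨∑ S : Finset (Fin k), Polynomial.C (A (S.piecewise (fun _ => s) fun _ => a))
    * Polynomial.X ^ S.card, ?_, fun t => ?_⟩
  · refine Polynomial.natDegree_sum_le_of_forall_le _ _ fun S _ => ?_
    refine (Polynomial.natDegree_C_mul_X_pow_le _ _).trans ?_
    simpa using S.card_le_univ
  · have h : (fun _ : Fin k => a + t • s) = (fun _ => t • s) + fun _ => a := by
      funext i; simp [add_comm]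
    rw [h, A.map_add_univ, Polynomial.eval_finsetSum]
    refine Finset.sum_congr rfl fun S _ => ?_
    have := A.toMultilinearMap.map_piecewise_smul (fun _ => t)
      (S.piecewise (fun _ => s) fun _ => a) S
    simp only [Finset.prod_const, smul_eq_mul] at this
    simp only [Polynomial.eval_mul, Polynomial.eval_C, Polynomial.eval_pow, Polynomial.eval_X]
    rw [mul_comm]
    refine Eq.trans (congrArg A ?_) this
    funext i
    by_cases hi : i ∈ S <;> simp [hi]

theorem quarticOnLines_taylorModel {d : ℕ} (L : ℝ) (f : Vec d → ℝ) (z : Vec d) :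
    QuarticOnLines (L / 12) (taylorModel 3 L f z) where
  contDiff := by
    have h (k : ℕ) : ContDiff ℝ 3 fun x : Vec d => (iteratedFDeriv ℝ k f z) fun _ => x - z :=
      (iteratedFDeriv ℝ k f z).contDiff.comp (by fun_prop)
    have h4 : ContDiff ℝ 3 fun x : Vec d => ‖x - z‖ ^ (3 + 1) := by
      have : (fun x : Vec d => ‖x - z‖ ^ (3 + 1)) = fun x => (‖x - z‖ ^ 2) ^ 2 := by
        funext x; ring
      rw [this]
      have h2 : ContDiff ℝ 3 fun x : Vec d => ‖x - z‖ ^ 2 :=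
        (contDiff_norm_sq ℝ).comp (contDiff_id.sub contDiff_const)
      exact h2.pow 2
    unfold taylorModel
    exact (ContDiff.sum fun k _ => (h k).div_const _).add (contDiff_const.mul h4)
  exists_coeff x s := by
    choose p hp hpe using fun k : ℕ =>
      (iteratedFDeriv ℝ k f z).exists_polynomial_line (x - z) s
    set P : Polynomial ℝ := ∑ k ∈ Finset.range 4, Polynomial.C ((k.factorial : ℝ)⁻¹) * p k
    have hP : P.natDegree < 4 := by
      refine Nat.lt_succ_of_le (Polynomial.natDegree_sum_le_of_forall_le _ _ fun k hk => ?_)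
      refine (Polynomial.natDegree_C_mul_le _ _).trans ((hp k).trans ?_)
      have := Finset.mem_range.1 hk
      omega
    have hPe (t : ℝ) : ∑ k ∈ Finset.range (3 + 1),
        ((iteratedFDeriv ℝ k f z) fun _ => x + t • s - z) / (k.factorial : ℝ) = P.eval t := by
      rw [Polynomial.eval_finsetSum]
      refine Finset.sum_congr rfl fun k _ => ?_
      rw [Polynomial.eval_mul, Polynomial.eval_C, ← hpe, div_eq_inv_mul,
        show x + t • s - z = x - z + t • s by abel]
    have hn (t : ℝ) : ‖x + t • s - z‖ ^ (3 + 1)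
        = (‖x - z‖ ^ 2 + 2 * inner ℝ (x - z) s * t + ‖s‖ ^ 2 * t ^ 2) ^ 2 := by
      rw [show x + t • s - z = x - z + t • s by abel,
        show ‖x - z + t • s‖ ^ (3 + 1) = (‖x - z + t • s‖ ^ 2) ^ 2 by ring, norm_add_sq_real,
        inner_smul_right, norm_smul, mul_pow, Real.norm_eq_abs, sq_abs]
      ring
    set A := ‖x - z‖ ^ 2
    set B := 2 * inner ℝ (x - z) s
    refine ⟨P.coeff 0 + L / 12 * A ^ 2, P.coeff 1 + L / 12 * (2 * A * B),
      P.coeff 2 + L / 12 * (2 * A * ‖s‖ ^ 2 + B ^ 2), P.coeff 3 + L / 12 * (2 * B * ‖s‖ ^ 2),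
      fun t => ?_⟩
    unfold taylorModel
    rw [hPe, hn, Polynomial.eval_eq_sum_range' hP]
    simp only [Finset.sum_range_succ, Finset.sum_range_zero]
    norm_num [Nat.factorial]
    ring

/-! ### Comparison of a function with its quartic model -/

theorem le_taylorModel {d : ℕ} {f : Vec d → ℝ} {L : ℝ} (hL0 : 0 ≤ L) (hf : ContDiff ℝ 3 f)
    (hL : HasLipschitzDerivs 3 L f Set.univ) (z x : Vec d) : f x ≤ taylorModel 3 L f z x := by
  have h := (abs_le.1 (abs_sub_taylor_le hf hL z (x - z))).2
  rw [add_sub_cancel] at h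
  have : 0 ≤ L * ‖x - z‖ ^ 4 := by positivity
  unfold taylorModel
  norm_num [Nat.factorial] at h ⊢
  linarith

theorem taylorModel_le {d : ℕ} {f : Vec d → ℝ} {L : ℝ} (hf : ContDiff ℝ 3 f)
    (hL : HasLipschitzDerivs 3 L f Set.univ) (z x : Vec d) :
    taylorModel 3 L f z x ≤ f x + L / 8 * ‖x - z‖ ^ 4 := by
  have h := (abs_le.1 (abs_sub_taylor_le hf hL z (x - z))).1
  rw [add_sub_cancel] at h
  unfold taylorModel
  norm_num [Nat.factorial] at h ⊢
  linarith

theorem taylorModel_self {d : ℕ} (L : ℝ) (f : Vec d → ℝ) (z : Vec d) :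
    taylorModel 3 L f z z = f z := by
  unfold taylorModel
  have (k : ℕ) : ((iteratedFDeriv ℝ (k + 1) f z) fun _ => (0 : Vec d)) = 0 :=
    ContinuousMultilinearMap.map_zero _
  simp only [Finset.sum_range_succ', sub_self, this]
  simp

theorem abs_sub_line_expansion_le {d : ℕ} {f : Vec d → ℝ} {L : ℝ} (hf : ContDiff ℝ 3 f)
    (hL : HasLipschitzDerivs 3 L f Set.univ) (x s : Vec d) : ∃ b : ℝ, ∀ t : ℝ,
    |f (x + t • s) - (f x + inner ℝ (gradient f x) s * t + quadForm (hessian f x) s / 2 * t ^ 2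
      + b * t ^ 3)| ≤ L / 24 * ‖s‖ ^ 4 * t ^ 4 := by
  refine ⟨(iteratedFDeriv ℝ 3 f x fun _ => s) / 6, fun t => ?_⟩
  have h := abs_sub_taylor_le hf hL x (t • s)
  have hs (k : ℕ) : (iteratedFDeriv ℝ k f x fun _ => t • s)
      = t ^ k * iteratedFDeriv ℝ k f x fun _ => s := by
    rw [ContinuousMultilinearMap.map_smul_univ]; simp
  simp only [hs] at h
  simp only [Finset.sum_range_succ, Finset.sum_range_zero] at h
  rw [iteratedFDeriv_one_const (hf.of_le (by norm_cast)), ← quadForm_hessian, norm_smul, mul_pow,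
    Real.norm_eq_abs, show |t| ^ 4 = t ^ 4 from Even.pow_abs (by decide) t] at h
  refine le_trans (le_of_eq ?_) (h.trans (le_of_eq (by ring)))
  simp only [iteratedFDeriv_zero_apply, Nat.factorial]
  norm_num
  congr 1; ring

theorem gradient_hessian_sub_bounds {d : ℕ} {f : Vec d → ℝ} {L : ℝ} (hf : ContDiff ℝ 3 f)
    (hL0 : 0 ≤ L) (hL : HasLipschitzDerivs 3 L f Set.univ) {z u : Vec d} {ρ : ℝ} (hρ : 0 < ρ)
    (hu : ‖u - z‖ ≤ ρ) {s : Vec d} (hs : ‖s‖ = 1) :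
    |inner ℝ (gradient f u) s - inner ℝ (gradient (taylorModel 3 L f z) u) s| ≤ 3 * L * ρ ^ 3 ∧
    |quadForm (hessian f u) s - quadForm (hessian (taylorModel 3 L f z) u) s|
      ≤ 5 * L * ρ ^ 2 := by
  obtain ⟨b, hb⟩ := abs_sub_line_expansion_le hf hL u s
  obtain ⟨c, hc⟩ := (quarticOnLines_taylorModel L f z).exists_expansion u s
  rw [hs] at hb hc
  have lo (t : ℝ) := le_taylorModel hL0 hf hL z (u + t • s)
  have hi (t : ℝ) (K : ℝ) (hK : |t| ≤ K * ρ) :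
      taylorModel 3 L f z (u + t • s) ≤ f (u + t • s) + L / 8 * ((1 + K) * ρ) ^ 4 := by
    refine (taylorModel_le hf hL z _).trans ?_
    have : ‖u + t • s - z‖ ≤ (1 + K) * ρ := by
      calc ‖u + t • s - z‖ = ‖(u - z) + t • s‖ := by congr 1; abel
        _ ≤ ‖u - z‖ + ‖t • s‖ := norm_add_le _ _
        _ ≤ _ := by rw [norm_smul, hs, Real.norm_eq_abs]; linarith
    gcongr
  have p0 := hi 0 0 (by simp)
  have p1 := hi ρ 1 (by rw [abs_of_pos hρ, one_mul])
  have p1' := hi (-ρ) 1 (by rw [abs_neg, abs_of_pos hρ, one_mul])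
  have p2 := hi (2 * ρ) 2 (by rw [abs_of_pos (by positivity)])
  have p2' := hi (-(2 * ρ)) 2 (by rw [abs_neg, abs_of_pos (by positivity)])
  have b1 := abs_le.1 (hb ρ)
  have b1' := abs_le.1 (hb (-ρ))
  have b2 := abs_le.1 (hb (2 * ρ))
  have b2' := abs_le.1 (hb (-(2 * ρ)))
  have l0 := lo 0
  have l1 := lo ρ
  have l1' := lo (-ρ)
  have l2 := lo (2 * ρ)
  have l2' := lo (-(2 * ρ))
  rw [zero_smul, add_zero] at l0 p0
  rw [hc] at l1 l1' l2 l2' p1 p1' p2 p2'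
  set g := inner ℝ (gradient f u) s
  set G := inner ℝ (gradient (taylorModel 3 L f z) u) s
  set q := quadForm (hessian f u) s
  set Q := quadForm (hessian (taylorModel 3 L f z) u) s
  have hW : 0 ≤ L * ρ ^ 4 := by positivity
  obtain ⟨b1, b1s⟩ := b1
  obtain ⟨b1', b1s'⟩ := b1'
  obtain ⟨b2, b2s⟩ := b2
  obtain ⟨b2', b2s'⟩ := b2'
  ring_nf at p0 p1 p1' p2 p2' b1 b1' b2 b2' b1s b1s' b2s b2s' l0 l1 l1' l2 l2' hW
  constructor
  · have h1 : (g - G) * ρ ≤ (3 * L * ρ ^ 3) * ρ := by ring_nf; linarith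
    have h2 : -(3 * L * ρ ^ 3) * ρ ≤ (g - G) * ρ := by ring_nf; linarith
    exact abs_le.2 ⟨le_of_mul_le_mul_right h2 hρ, le_of_mul_le_mul_right h1 hρ⟩
  · have h1 : (q - Q) * ρ ^ 2 ≤ (5 * L * ρ ^ 2) * ρ ^ 2 := by ring_nf; linarith
    have h2 : -(5 * L * ρ ^ 2) * ρ ^ 2 ≤ (q - Q) * ρ ^ 2 := by ring_nf; linarith
    have : 0 < ρ ^ 2 := by positivity
    exact abs_le.2 ⟨le_of_mul_le_mul_right h2 this, le_of_mul_le_mul_right h1 this⟩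

theorem norm_le_of_inner_unit_le {d : ℕ} {v : Vec d} {c : ℝ} (hc : 0 ≤ c)
    (h : ∀ s : Vec d, ‖s‖ = 1 → inner ℝ v s ≤ c) : ‖v‖ ≤ c := by
  by_cases hv : v = 0
  · simpa [hv] using hc
  · have hn : ‖v‖ ≠ 0 := norm_ne_zero_iff.2 hv
    have := h (‖v‖⁻¹ • v) (by simp [norm_smul, inv_mul_cancel₀ hn])
    rw [inner_smul_right, real_inner_self_eq_norm_sq] at this
    calc ‖v‖ = ‖v‖⁻¹ * ‖v‖ ^ 2 := by field_simp
      _ ≤ c := this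

theorem norm_gradient_sub_le {d : ℕ} {f : Vec d → ℝ} {L : ℝ} (hf : ContDiff ℝ 3 f)
    (hL0 : 0 ≤ L) (hL : HasLipschitzDerivs 3 L f Set.univ) {z u : Vec d} {ρ : ℝ} (hρ : 0 < ρ)
    (hu : ‖u - z‖ ≤ ρ) :
    ‖gradient f u - gradient (taylorModel 3 L f z) u‖ ≤ 3 * L * ρ ^ 3 := by
  refine norm_le_of_inner_unit_le (by positivity) fun s hs => ?_
  rw [inner_sub_left]
  exact (abs_le.1 (gradient_hessian_sub_bounds hf hL0 hL hρ hu hs).1).2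

theorem quadForm_smul {d : ℕ} (A : Matrix (Fin d) (Fin d) ℝ) (c : ℝ) (s : Vec d) :
    quadForm A (c • s) = c ^ 2 * quadForm A s := by
  have : (fun i => (c • s) i) = c • fun i => s i := by ext i; simp
  unfold quadForm
  rw [this, Matrix.mulVec_smul, smul_dotProduct, dotProduct_smul, smul_eq_mul, smul_eq_mul]
  ring

theorem abs_quadForm_sub_le {d : ℕ} {f : Vec d → ℝ} {L : ℝ} (hf : ContDiff ℝ 3 f)
    (hL0 : 0 ≤ L) (hL : HasLipschitzDerivs 3 L f Set.univ) {z u : Vec d} {ρ : ℝ} (hρ : 0 < ρ)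
    (hu : ‖u - z‖ ≤ ρ) (s : Vec d) :
    |quadForm (hessian f u) s - quadForm (hessian (taylorModel 3 L f z) u) s|
      ≤ 5 * L * ρ ^ 2 * ‖s‖ ^ 2 := by
  by_cases h : s = 0
  · have h0 (A : Matrix (Fin d) (Fin d) ℝ) : quadForm A 0 = 0 := by
      simpa using quadForm_smul A 0 0
    simp [h, h0]
  · have hn : ‖s‖ ≠ 0 := norm_ne_zero_iff.2 h
    have hs : s = ‖s‖ • (‖s‖⁻¹ • s) := by rw [smul_smul, mul_inv_cancel₀ hn, one_smul]
    have hu := (gradient_hessian_sub_bounds hf hL0 hL hρ hu (s := ‖s‖⁻¹ • s)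
      (by simp [norm_smul, inv_mul_cancel₀ hn])).2
    rw [show quadForm (hessian f u) s = ‖s‖ ^ 2 * quadForm (hessian f u) (‖s‖⁻¹ • s) by
      rw [← quadForm_smul, ← hs], show quadForm (hessian (taylorModel 3 L f z) u) s
      = ‖s‖ ^ 2 * quadForm (hessian (taylorModel 3 L f z) u) (‖s‖⁻¹ • s) by
      rw [← quadForm_smul, ← hs], ← mul_sub, abs_mul, abs_of_nonneg (by positivity), mul_comm]
    gcongr

theorem QuarticOnLines.le_quadratic {d : ℕ} {c : ℝ} {F : Vec d → ℝ} (hF : QuarticOnLines c F)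
    {x w : Vec d} {B : ℝ} (h0 : quadForm (hessian F x) w ≤ B)
    (h1 : quadForm (hessian F (x + (1 / 2 : ℝ) • w)) w ≤ B) :
    F (x + w) ≤ F x + inner ℝ (gradient F x) w + B / 2 := by
  obtain ⟨a, ha⟩ := hF.exists_expansion x w
  obtain ⟨b, hb⟩ := hF.exists_expansion (x + (1 / 2 : ℝ) • w) w
  have a1 := ha 1
  have a2 := ha (1 / 2)
  have b1 := hb (1 / 2)
  have b2 := hb (-(1 / 2))
  rw [one_smul] at a1
  rw [add_assoc, ← add_smul, show (1 / 2 + 1 / 2 : ℝ) = 1 by norm_num, one_smul] at b1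
  rw [add_assoc, ← add_smul, show (1 / 2 + -(1 / 2) : ℝ) = 0 by norm_num, zero_smul,
    add_zero] at b2
  linarith

theorem taylorModel_le_quadratic {d : ℕ} {f : Vec d → ℝ} {L₁ L : ℝ} (hf : ContDiff ℝ 3 f)
    (hL₁0 : 0 ≤ L₁) (hL0 : 0 ≤ L) (hL₁ : HasLipschitzDerivs 1 L₁ f Set.univ)
    (hL : HasLipschitzDerivs 3 L f Set.univ) {z x w : Vec d} {ρ : ℝ} (hρ : 0 < ρ)
    (hx : ‖x - z‖ + ‖w‖ ≤ ρ) (hρL : 5 * L * ρ ^ 2 ≤ L₁) :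
    taylorModel 3 L f z (x + w) ≤ taylorModel 3 L f z x
      + inner ℝ (gradient (taylorModel 3 L f z) x) w + L₁ * ‖w‖ ^ 2 := by
  have key (y : Vec d) (hy : ‖y - z‖ ≤ ρ) :
      quadForm (hessian (taylorModel 3 L f z) y) w ≤ 2 * L₁ * ‖w‖ ^ 2 := by
    have h1 := (abs_le.1 (abs_quadForm_sub_le hf hL0 hL hρ hy w)).1
    have h2 := quadForm_hessian_le hL₁0 hf hL₁ y w
    have h3 : 5 * L * ρ ^ 2 * ‖w‖ ^ 2 ≤ L₁ * ‖w‖ ^ 2 := by gcongr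
    linarith
  have := (quarticOnLines_taylorModel L f z).le_quadratic
    (key x (by linarith [norm_nonneg w])) (key (x + (1 / 2 : ℝ) • w) (by
      calc ‖x + (1 / 2 : ℝ) • w - z‖ = ‖(x - z) + (1 / 2 : ℝ) • w‖ := by congr 1; abel
        _ ≤ ‖x - z‖ + ‖(1 / 2 : ℝ) • w‖ := norm_add_le _ _
        _ ≤ ρ := by rw [norm_smul]; norm_num; linarith [norm_nonneg w]))
  linarith

end

/-! ### First minimizers and the exploitation of negative curvature -/

theorem argminFirst_mem_and_le {ι : Type} (φ : ι → ℝ) (a : ι) (l : List ι) :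
    argminFirst φ a l ∈ a :: l ∧ ∀ b ∈ a :: l, φ (argminFirst φ a l) ≤ φ b := by
  induction l generalizing a with
  | nil => simp [argminFirst]
  | cons x l ih =>
    have h : argminFirst φ a (x :: l)
        = argminFirst φ (open Classical in if φ x < φ a then x else a) l := rfl
    rw [h]
    split_ifs with hx
    · obtain ⟨h1, h2⟩ := ih x
      refine ⟨List.mem_cons_of_mem _ h1, fun b hb => ?_⟩
      rcases List.mem_cons.1 hb with rfl | hb
      · exact (h2 x (by simp)).trans hx.le
      · exact h2 b hb
    · obtain ⟨h1, h2⟩ := ih a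
      refine ⟨?_, fun b hb => ?_⟩
      · rcases List.mem_cons.1 h1 with h1 | h1
        · rw [h1]; simp
        · simp [h1]
      · rcases List.mem_cons.1 hb with rfl | hb
        · exact h2 _ (by simp)
        rcases List.mem_cons.1 hb with rfl | hb
        · exact (h2 a (by simp)).trans (not_lt.1 hx)
        · exact h2 b (by simp [hb])

/-- The point returned by `exploitNC`. -/
noncomputable def exploitPoint {d : ℕ} (F : Vec d → ℝ) (c s : Vec d) (R : ℝ) : Vec d :=
  c + argminFirst (fun θ : ℝ => F (c + θ • s)) (12 * R) [9 * R, -9 * R, -12 * R] • s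

theorem exploitPoint_le {d : ℕ} (F : Vec d → ℝ) (c s : Vec d) (R : ℝ) :
    F (exploitPoint F c s R) ≤ F (c + (12 * R) • s) ∧
    F (exploitPoint F c s R) ≤ F (c + (9 * R) • s) ∧
    F (exploitPoint F c s R) ≤ F (c + (-9 * R) • s) ∧
    F (exploitPoint F c s R) ≤ F (c + (-12 * R) • s) := by
  have h := (argminFirst_mem_and_le (fun θ : ℝ => F (c + θ • s)) (12 * R)
    [9 * R, -9 * R, -12 * R]).2
  exact ⟨h _ (by simp), h _ (by simp), h _ (by simp), h _ (by simp)⟩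

theorem norm_exploitPoint_sub_le {d : ℕ} (F : Vec d → ℝ) (c : Vec d) {s : Vec d} {R : ℝ}
    (hR : 0 ≤ R) (hs : ‖s‖ = 1) : ‖exploitPoint F c s R - c‖ ≤ 12 * R := by
  have h := (argminFirst_mem_and_le (fun θ : ℝ => F (c + θ • s)) (12 * R)
    [9 * R, -9 * R, -12 * R]).1
  unfold exploitPoint
  rw [add_sub_cancel_left, norm_smul, hs, mul_one, Real.norm_eq_abs]
  simp only [List.mem_cons, List.not_mem_nil, or_false] at h
  rcases h with h | h | h | h <;> rw [h, abs_le] <;> constructor <;> linarith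

theorem exploitPoint_le_of_quadForm {d : ℕ} {F : Vec d → ℝ} {L R : ℝ}
    (hF : QuarticOnLines (L / 12) F) (hL : 0 ≤ L) (hR : 0 < R) {u p : Vec d} (hp : ‖p‖ = 1)
    (h : quadForm (hessian F u) p ≤ -(42 * L * R ^ 2)) :
    F (exploitPoint F u p R) ≤ F u - 21 * L * R ^ 4 := by
  obtain ⟨-, h1, h2, -⟩ := exploitPoint_le F u p R
  obtain ⟨b, hb⟩ := hF.exists_expansion u p
  rw [hb, hp] at h1 h2
  have h3 := mul_le_mul_of_nonneg_right h (show 0 ≤ R ^ 2 by positivity)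
  have h4 : 0 ≤ L * R ^ 4 := by positivity
  ring_nf at h1 h2 h3 h4 ⊢
  linarith

theorem le_sub_of_four_points {m q₀ c₁ c₂ c₃ L R a : ℝ} (hL : 0 ≤ L) (hR : 0 < R) (ha : 0 ≤ a)
    (haR : a ≤ R) (h : c₂ + c₃ * a + L / 6 * a ^ 2 + 21 * L * R ^ 2 ≤ 0)
    (hm : ∀ t ∈ [12 * R, 9 * R, -9 * R, -12 * R],
      m ≤ q₀ + c₁ * t + c₂ * t ^ 2 + c₃ * t ^ 3 + L / 12 * t ^ 4) :
    m ≤ (q₀ + c₁ * (-a) + c₂ * (-a) ^ 2 + c₃ * (-a) ^ 3 + L / 12 * (-a) ^ 4)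
      - 21 * L * R ^ 4 := by
  obtain ⟨k, rfl⟩ : ∃ k, a = k * R := ⟨a / R, by field_simp⟩
  have hk0 : 0 ≤ k := nonneg_of_mul_nonneg_left ha hR
  have hk1 : k ≤ 1 := le_of_mul_le_mul_right (by linarith) hR
  have hk2 : k ^ 2 ≤ 1 := by nlinarith
  have hk3 : 0 ≤ k ^ 3 := by positivity
  have hk3' : k ^ 3 ≤ k := by nlinarith
  have p1 := hm (12 * R) (by simp)
  have p2 := hm (9 * R) (by simp)
  have p3 := hm (-9 * R) (by simp)
  have p4 := hm (-12 * R) (by simp)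
  set x := k * (387 / 2 - 2 * k ^ 2) / 756 with hx
  set y := (k + 12 * x) / 9 with hy
  have hx0 : 0 ≤ x := by rw [hx]; nlinarith
  have hx1 : x ≤ 1 / 2 := by rw [hx]; nlinarith
  have hy0 : 0 ≤ y := by rw [hy]; positivity
  have hy1 : y ≤ 1 / 2 := by rw [hy, hx]; nlinarith
  have w1 := mul_le_mul_of_nonneg_left p1 (show 0 ≤ (1 / 2 + x) / 2 by linarith)
  have w2 := mul_le_mul_of_nonneg_left p2 (show 0 ≤ (1 / 2 - y) / 2 by linarith)
  have w3 := mul_le_mul_of_nonneg_left p3 (show 0 ≤ (1 / 2 + y) / 2 by linarith)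
  have w4 := mul_le_mul_of_nonneg_left p4 (show 0 ≤ (1 / 2 - x) / 2 by linarith)
  have hfac : 0 ≤ (225 / 2 - k ^ 2) * R ^ 2 := mul_nonneg (by linarith) (by positivity)
  have h5 := mul_le_mul_of_nonneg_left h hfac
  have h6 : m ≤ q₀ + c₁ * (-(k * R)) + (225 / 2) * c₂ * R ^ 2
      + c₃ * ((225 / 2 - 2 * k ^ 2) * k * R ^ 3) + L / 12 * (27297 / 2 * R ^ 4) := by
    have e : q₀ + c₁ * (-(k * R)) + (225 / 2) * c₂ * R ^ 2
      + c₃ * ((225 / 2 - 2 * k ^ 2) * k * R ^ 3) + L / 12 * (27297 / 2 * R ^ 4) = 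
      (1 / 2 + x) / 2 * (q₀ + c₁ * (12 * R) + c₂ * (12 * R) ^ 2 + c₃ * (12 * R) ^ 3 + L / 12 * (12 * R) ^ 4)
      + (1 / 2 - y) / 2 * (q₀ + c₁ * (9 * R) + c₂ * (9 * R) ^ 2 + c₃ * (9 * R) ^ 3 + L / 12 * (9 * R) ^ 4)
      + (1 / 2 + y) / 2 * (q₀ + c₁ * (-9 * R) + c₂ * (-9 * R) ^ 2 + c₃ * (-9 * R) ^ 3 + L / 12 * (-9 * R) ^ 4)
      + (1 / 2 - x) / 2 * (q₀ + c₁ * (-12 * R) + c₂ * (-12 * R) ^ 2 + c₃ * (-12 * R) ^ 3 + L / 12 * (-12 * R) ^ 4) := by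
      rw [hy, hx]; ring
    rw [e]; linarith
  have h7 : 0 ≤ L * R ^ 4 := by positivity
  have h8 : 0 ≤ L * R ^ 4 * k ^ 2 * (225 / 2 - k ^ 2) :=
    mul_nonneg (by positivity) (by linarith)
  have h9 : L * R ^ 4 * k ^ 2 ≤ L * R ^ 4 := mul_le_of_le_one_right h7 hk2
  have h10 : 0 ≤ L * R ^ 4 * k ^ 4 := by positivity
  ring_nf at h5 h6 h7 h8 h9 h10 ⊢
  linarith

/-! ### Quadratic penalization -/

/-- The proximally regularized function `x ↦ F x + α / 2 ‖z - x‖²`. -/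
noncomputable def penalized {d : ℕ} (α : ℝ) (F : Vec d → ℝ) (z : Vec d) : Vec d → ℝ :=
  fun x => F x + α / 2 * ‖z - x‖ ^ 2

theorem hasGradientAt_penalized {d : ℕ} (α : ℝ) {F : Vec d → ℝ} (hF : Differentiable ℝ F)
    (z x : Vec d) :
    HasGradientAt (penalized α F z) (gradient F x + α • (x - z)) x := by
  have h1 := (hF x).hasGradientAt.hasFDerivAt
  have h2 : HasFDerivAt (fun y : Vec d => z - y) (-ContinuousLinearMap.id ℝ (Vec d)) x :=
    (hasFDerivAt_id x).const_sub z
  have h3 := h1.add ((h2.norm_sq).const_mul (α / 2))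
  rw [hasGradientAt_iff_hasFDerivAt]
  refine h3.congr_fderiv ?_
  ext y
  simp
  ring

theorem differentiable_penalized {d : ℕ} (α : ℝ) {F : Vec d → ℝ} (hF : Differentiable ℝ F)
    (z : Vec d) : Differentiable ℝ (penalized α F z) :=
  fun x => (hasGradientAt_penalized α hF z x).differentiableAt

theorem gradient_penalized {d : ℕ} (α : ℝ) {F : Vec d → ℝ} (hF : Differentiable ℝ F)
    (z x : Vec d) : gradient (penalized α F z) x = gradient F x + α • (x - z) :=
  (hasGradientAt_penalized α hF z x).gradient

theorem le_penalized {d : ℕ} {α : ℝ} (hα : 0 ≤ α) (F : Vec d → ℝ) (z x : Vec d) :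
    F x ≤ penalized α F z x :=
  le_add_of_nonneg_right (by positivity)

theorem penalized_self {d : ℕ} (α : ℝ) (F : Vec d → ℝ) (z : Vec d) :
    penalized α F z z = F z := by
  simp [penalized]

theorem penalized_add {d : ℕ} {α : ℝ} {F : Vec d → ℝ} (hF : Differentiable ℝ F) {z x w : Vec d}
    {B : ℝ} (h : F (x + w) ≤ F x + inner ℝ (gradient F x) w + B * ‖w‖ ^ 2) :
    penalized α F z (x + w) ≤ penalized α F z x + inner ℝ (gradient (penalized α F z) x) w
      + (2 * B + α) / 2 * ‖w‖ ^ 2 := by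
  rw [gradient_penalized α hF, inner_add_left, inner_smul_left]
  unfold penalized
  have e1 : ‖z - (x + w)‖ ^ 2 = ‖z - x‖ ^ 2 + 2 * inner ℝ (x - z) w + ‖w‖ ^ 2 := by
    rw [show z - (x + w) = -((x - z) + w) by abel, norm_neg, norm_add_sq_real,
      norm_sub_rev x z]
  rw [e1]
  simp only [conj_trivial]
  linarith

theorem exploitPoint_le_of_certificate {d : ℕ} {F : Vec d → ℝ} {L R : ℝ}
    (hF : QuarticOnLines (L / 12) F) (hL : 0 ≤ L) (hR : 0 < R) {z u v : Vec d}
    (huv : ‖u - v‖ ≤ 2 * R)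
    (h : penalized (42 * L * R ^ 2) F z u < penalized (42 * L * R ^ 2) F z v
      + inner ℝ (gradient (penalized (42 * L * R ^ 2) F z) v) (u - v)) :
    F (exploitPoint F ((1 / 2 : ℝ) • (u + v)) ((1 / ‖u - v‖) • (v - u)) R)
      ≤ F u - 21 * L * R ^ 4 := by
  set α := 42 * L * R ^ 2 with hα
  have hd := hF.contDiff.differentiable (by simp)
  have hne : u - v ≠ 0 := by
    intro h0
    rw [h0, inner_zero_right, sub_eq_zero.1 h0] at h
    linarith
  have hn : 0 < ‖u - v‖ := norm_pos_iff.2 hne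
  set c : Vec d := (1 / 2 : ℝ) • (u + v) with hc
  set s : Vec d := (1 / ‖u - v‖) • (v - u) with hs
  set a := ‖u - v‖ / 2 with ha
  have ha0 : 0 < a := by positivity
  have hs1 : ‖s‖ = 1 := by
    rw [hs, norm_smul, norm_sub_rev v u, norm_div, norm_norm, norm_one, one_div,
      inv_mul_cancel₀ hn.ne']
  have has : a • s = (1 / 2 : ℝ) • (v - u) := by
    rw [hs, smul_smul]; congr 1; rw [ha]; field_simp
  have hv : c + a • s = v := by rw [has, hc]; module
  have hu : c + (-a) • s = u := by rw [neg_smul, has, hc]; module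
  obtain ⟨b, hb⟩ := hF.exists_expansion c s
  obtain ⟨m1, m2, m3, m4⟩ := exploitPoint_le F c s R
  rw [hb, hs1] at m1 m2 m3 m4
  have e1 (t : ℝ) : ‖z - (c + t • s)‖ ^ 2
      = ‖c - z‖ ^ 2 + 2 * inner ℝ (c - z) s * t + t ^ 2 := by
    rw [show z - (c + t • s) = -((c - z) + t • s) by abel, norm_neg, norm_add_sq_real,
      norm_smul, hs1, inner_smul_right, mul_one, Real.norm_eq_abs, sq_abs]
    ring
  have hF' : (fun t : ℝ => penalized α F z (c + t • s)) = fun t =>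
      (F c + α / 2 * ‖c - z‖ ^ 2)
      + (inner ℝ (gradient F c) s + α * inner ℝ (c - z) s) * t ^ 1
      + (quadForm (hessian F c) s / 2 + α / 2) * t ^ 2 + b * t ^ 3 + L / 12 * t ^ 4 := by
    funext t
    unfold penalized
    rw [hb, e1, hs1]; ring
  have hder := hasDerivAt_line (differentiable_penalized α hd z) c s a
  rw [hv, hF'] at hder
  have hp (k : ℝ) (n : ℕ) (t : ℝ) : HasDerivAt (fun t : ℝ => k * t ^ (n + 1))
      (k * ((n + 1 : ℕ) * t ^ n)) t := by
    simpa using (hasDerivAt_pow (n + 1) t).const_mul k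
  have hder' := hder.unique (((((hasDerivAt_const a _).add (hp _ 0 a)).add (hp _ 1 a)).add
    (hp _ 2 a)).add (hp _ 3 a))
  have hin : inner ℝ (gradient (penalized α F z) v) (u - v)
      = -(2 * a) * inner ℝ (gradient (penalized α F z) v) s := by
    rw [← inner_smul_right]; congr 1
    rw [neg_smul, mul_smul, has]; module
  have hpu : penalized α F z u = _ := (congrArg _ hu.symm).trans (congrFun hF' (-a))
  have hpv : penalized α F z v = _ := (congrArg _ hv.symm).trans (congrFun hF' a)
  rw [hin, hder', hpu, hpv] at h
  set Q := quadForm (hessian F c) s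
  have hkey : Q / 2 + b * a + L / 6 * a ^ 2 + 21 * L * R ^ 2 ≤ 0 := by
    have : a ^ 2 * (Q / 2 + b * a + L / 6 * a ^ 2 + 21 * L * R ^ 2) ≤ 0 := by
      push_cast at h
      rw [hα] at h
      ring_nf at h ⊢
      linarith
    by_contra hcon
    have := mul_pos (pow_pos ha0 2) (not_le.1 hcon)
    linarith
  have fin := le_sub_of_four_points (m := F (exploitPoint F c s R)) (q₀ := F c)
    (c₁ := inner ℝ (gradient F c) s) hL hR ha0.le (by rw [ha]; linarith) hkey (by
      intro t ht
      simp only [List.mem_cons, List.not_mem_nil, or_false] at ht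
      rcases ht with rfl | rfl | rfl | rfl <;> linarith)
  have hFu := hb (-a)
  rw [hu, hs1] at hFu
  linarith

/-! ### One step of the trust-region method -/

/-- The point returned by the trust-region routine from the point `u` and the optional certificate
`v`. -/
noncomputable def nextPoint {d : ℕ} (svd : Matrix (Fin d) (Fin d) ℝ → Vec d) (F : Vec d → ℝ)
    (ε α R : ℝ) (u : Vec d) (v : Option (Vec d)) : Vec d :=
  open Classical in
  if ‖gradient F u‖ ≤ ε then
    if -α ≤ quadForm (hessian F u) (svd (hessian F u)) then u
    else exploitPoint F u (svd (hessian F u)) R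
  else
    match v with
    | none => u
    | some v => exploitPoint F ((1 / 2 : ℝ) • (u + v)) ((1 / ‖u - v‖) • (v - u)) R

/-- Approximate second order stationarity. -/
def IsApproxStationary {d : ℕ} (f : Vec d → ℝ) (ε δ : ℝ) (u : Vec d) : Prop :=
  ‖gradient f u‖ ≤ ε ∧ ∀ s, -δ * ‖s‖ ^ 2 ≤ quadForm (hessian f u) s

theorem hessian_isSymm {d : ℕ} {F : Vec d → ℝ} (hF : ContDiff ℝ 3 F) (u : Vec d) :
    (hessian F u).IsSymm := by
  ext i j
  have h : IsSymmSndFDerivAt ℝ F u :=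
    hF.contDiffAt.isSymmSndFDerivAt (by simp; norm_cast)
  simp only [hessian, Matrix.transpose_apply, Matrix.of_apply, iteratedFDeriv_two_apply,
    Matrix.cons_val_zero, Matrix.cons_val_one]
  exact h _ _

theorem IsMinDirection.le_quadForm {d : ℕ} {svd : Matrix (Fin d) (Fin d) ℝ → Vec d}
    (hsvd : IsMinDirection svd) {A : Matrix (Fin d) (Fin d) ℝ} (hA : A.IsSymm) (s : Vec d) :
    quadForm A (svd A) * ‖s‖ ^ 2 ≤ quadForm A s := by
  by_cases h : s = 0
  · have h0 : quadForm A (0 : Vec d) = 0 := by simpa using quadForm_smul A 0 0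
    simp [h, h0]
  · have hn : ‖s‖ ≠ 0 := norm_ne_zero_iff.2 h
    have hs : s = ‖s‖ • (‖s‖⁻¹ • s) := by rw [smul_smul, mul_inv_cancel₀ hn, one_smul]
    have := hsvd.isMin A hA (‖s‖⁻¹ • s) (by simp [norm_smul, inv_mul_cancel₀ hn])
    rw [show quadForm A s = ‖s‖ ^ 2 * quadForm A (‖s‖⁻¹ • s) by rw [← quadForm_smul, ← hs],
      mul_comm]
    gcongr

/-- The standing assumptions on the objective in terms of the trust-region radius `R`. -/
structure StepAssumptions {d : ℕ} (f : Vec d → ℝ) (L₁ L R : ℝ) : Prop where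
  contDiff : ContDiff ℝ 3 f
  lip₁ : HasLipschitzDerivs 1 L₁ f Set.univ
  lip₃ : HasLipschitzDerivs 3 L f Set.univ
  L_pos : 0 < L
  R_pos : 0 < R
  le_L₁ : 576 * L * R ^ 2 ≤ L₁

section

variable {d : ℕ} {f : Vec d → ℝ} {L₁ L R : ℝ} {svd : Matrix (Fin d) (Fin d) ℝ → Vec d}

theorem differentiable_taylorModel (z : Vec d) :
    Differentiable ℝ (taylorModel 3 L f z) :=
  (quarticOnLines_taylorModel L f z).contDiff.differentiable (by simp)

theorem StepAssumptions.isApproxStationary (h : StepAssumptions f L₁ L R) {z u : Vec d}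
    (hu : ‖u - z‖ ≤ R) (h1 : ‖gradient (taylorModel 3 L f z) u‖ ≤ 6912 * L * R ^ 3)
    (h2 : ∀ s, -(42 * L * R ^ 2) * ‖s‖ ^ 2 ≤ quadForm (hessian (taylorModel 3 L f z) u) s) :
    IsApproxStationary f (13824 * L * R ^ 3) (576 * L * R ^ 2) u := by
  have hL := h.L_pos
  have hR := h.R_pos
  constructor
  · have h3 := norm_gradient_sub_le h.contDiff hL.le h.lip₃ hR hu
    have h4 := norm_le_norm_add_norm_sub' (gradient f u) (gradient (taylorModel 3 L f z) u)
    have : 0 ≤ L * R ^ 3 := by positivity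
    linarith
  · intro s
    have h3 := (abs_le.1 (abs_quadForm_sub_le h.contDiff hL.le h.lip₃ hR hu s)).1
    have h4 := h2 s
    have : 0 ≤ L * R ^ 2 * ‖s‖ ^ 2 := by positivity
    linarith

theorem StepAssumptions.taylorModel_nextPoint_le (h : StepAssumptions f L₁ L R)
    (hsvd : IsMinDirection svd) (z u : Vec d) {ε : ℝ} :
    taylorModel 3 L f z (nextPoint svd (taylorModel 3 L f z) ε (42 * L * R ^ 2) R u none)
      ≤ taylorModel 3 L f z u := by
  unfold nextPoint
  have hQ := quarticOnLines_taylorModel L f z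
  split_ifs with h1 h2
  · exact le_rfl
  · have hs := hsvd.norm_eq _ (hessian_isSymm hQ.contDiff u)
    have := exploitPoint_le_of_quadForm hQ h.L_pos.le h.R_pos hs (not_le.1 h2).le
    have h3 : 0 ≤ L * R ^ 4 := by have := h.L_pos; positivity
    linarith
  · exact le_rfl

theorem norm_nextPoint_none_sub_le (hR : 0 ≤ R) (hsvd : IsMinDirection svd) {F : Vec d → ℝ}
    (hF : ContDiff ℝ 3 F) (u : Vec d) {ε α : ℝ} :
    ‖nextPoint svd F ε α R u none - u‖ ≤ 12 * R := by
  unfold nextPoint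
  split_ifs with h1 h2
  · simpa using hR
  · exact norm_exploitPoint_sub_le F u hR (hsvd.norm_eq _ (hessian_isSymm hF u))
  · simpa using hR

theorem StepAssumptions.of_near (h : StepAssumptions f L₁ L R) (hsvd : IsMinDirection svd)
    {z u : Vec d} {v : Option (Vec d)} (hu : ‖u - z‖ ≤ R)
    (hle : taylorModel 3 L f z u ≤ f z)
    (hv : ‖gradient (taylorModel 3 L f z) u‖ ≤ 6912 * L * R ^ 3 ∨ ∃ y ∈ v, ‖y - z‖ ≤ R ∧
      penalized (42 * L * R ^ 2) (taylorModel 3 L f z) z u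
        < penalized (42 * L * R ^ 2) (taylorModel 3 L f z) z y
          + inner ℝ (gradient (penalized (42 * L * R ^ 2) (taylorModel 3 L f z) z) y) (u - y)) :
    IsApproxStationary f (13824 * L * R ^ 3) (576 * L * R ^ 2)
      (nextPoint svd (taylorModel 3 L f z) (6912 * L * R ^ 3) (42 * L * R ^ 2) R u v) ∨
    f (nextPoint svd (taylorModel 3 L f z) (6912 * L * R ^ 3) (42 * L * R ^ 2) R u v)
      ≤ f z - 21 * L * R ^ 4 := by
  have hQ := quarticOnLines_taylorModel L f z
  have hS := hessian_isSymm hQ.contDiff u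
  have hlow := le_taylorModel h.L_pos.le h.contDiff h.lip₃ z
  unfold nextPoint
  split_ifs with h1 h2
  · refine Or.inl (h.isApproxStationary hu h1 fun s => ?_)
    exact (mul_le_mul_of_nonneg_right h2 (by positivity)).trans (hsvd.le_quadForm hS s)
  · have := exploitPoint_le_of_quadForm hQ h.L_pos.le h.R_pos (hsvd.norm_eq _ hS)
      (not_le.1 h2).le
    exact Or.inr ((hlow _).trans (by linarith))
  · obtain ⟨y, hy, hyz, hlt⟩ := hv.resolve_left h1
    rw [Option.mem_def] at hy
    subst hy
    have huv : ‖u - y‖ ≤ 2 * R := by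
      have := norm_sub_le_norm_sub_add_norm_sub u z y
      rw [norm_sub_rev z y] at this
      linarith
    have := exploitPoint_le_of_certificate hQ h.L_pos.le h.R_pos huv hlt
    exact Or.inr ((hlow _).trans (by linarith))

theorem StepAssumptions.of_small_gradient (h : StepAssumptions f L₁ L R)
    (hsvd : IsMinDirection svd) {z x : Vec d} (hx : ‖x - z‖ ≤ R)
    (hle : penalized (42 * L * R ^ 2) (taylorModel 3 L f z) z x ≤ f z)
    (hg : ‖gradient (penalized (42 * L * R ^ 2) (taylorModel 3 L f z) z) x‖ ≤ 3456 * L * R ^ 3) :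
    IsApproxStationary f (13824 * L * R ^ 3) (576 * L * R ^ 2)
      (nextPoint svd (taylorModel 3 L f z) (6912 * L * R ^ 3) (42 * L * R ^ 2) R x none) ∨
    f (nextPoint svd (taylorModel 3 L f z) (6912 * L * R ^ 3) (42 * L * R ^ 2) R x none)
      ≤ f z - 21 * L * R ^ 4 := by
  have hL := h.L_pos
  have hR := h.R_pos
  refine h.of_near hsvd hx ((le_penalized (by positivity) _ _ _).trans hle) (Or.inl ?_)
  rw [gradient_penalized _ (differentiable_taylorModel z)] at hg
  have h1 := norm_sub_le (gradient (taylorModel 3 L f z) x + (42 * L * R ^ 2) • (x - z))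
    ((42 * L * R ^ 2) • (x - z))
  rw [add_sub_cancel_right, norm_smul, Real.norm_of_nonneg (by positivity)] at h1
  have h2 : 42 * L * R ^ 2 * ‖x - z‖ ≤ 42 * L * R ^ 2 * R := by gcongr
  have h3 : 0 ≤ L * R ^ 3 := by positivity
  linarith

/-- The sampled point improves on the best query point if it is not too far from it. -/
theorem StepAssumptions.penalized_lt (h : StepAssumptions f L₁ L R) {z x u e g : Vec d}
    (hx : ‖x - z‖ ≤ R)
    (hgdef : g = gradient (penalized (42 * L * R ^ 2) (taylorModel 3 L f z) z) x)
    (hg : 3456 * L * R ^ 3 < ‖g‖)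
    (hu : u = x - (1 / (2 * L₁ + 42 * L * R ^ 2)) • g + e)
    (he : ‖e‖ ≤ 3456 * L * R ^ 3 / (8 * (2 * L₁ + 42 * L * R ^ 2))) (hw : ‖u - x‖ ≤ 3 * R) :
    penalized (42 * L * R ^ 2) (taylorModel 3 L f z) z u
      < penalized (42 * L * R ^ 2) (taylorModel 3 L f z) z x := by
  have hL := h.L_pos
  have hR := h.R_pos
  have hLR : 0 < L * R ^ 2 := by positivity
  have hL₁ : 0 < L₁ := by have := h.le_L₁; linarith
  set α := 42 * L * R ^ 2
  have hα : 0 < α := by positivity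
  set w := u - x with hwd
  have h1 := taylorModel_le_quadratic (z := z) (x := x) (w := w) (ρ := 4 * R) h.contDiff hL₁.le
    hL.le h.lip₁ h.lip₃ (by positivity) (by linarith) (by have := h.le_L₁; linarith)
  have h2 := penalized_add (z := z) (α := α) (differentiable_taylorModel z) h1
  rw [show x + w = u by rw [hwd]; abel, ← hgdef] at h2
  set Lh := 2 * L₁ + α with hLh
  have hLh0 : 0 < Lh := by positivity
  have hgw : g = Lh • (e - w) := by
    rw [hwd, hu, show e - (x - (1 / Lh) • g + e - x) = (1 / Lh) • g by abel, smul_smul,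
      mul_one_div_cancel hLh0.ne', one_smul]
  have hn : ‖g‖ = Lh * ‖e - w‖ := by
    rw [hgw, norm_smul, Real.norm_of_nonneg hLh0.le]
  have hlt : ‖e‖ < ‖e - w‖ := by
    refine lt_of_mul_lt_mul_left ?_ hLh0.le
    rw [← hn]
    have : Lh * ‖e‖ ≤ 3456 * L * R ^ 3 / 8 := by
      calc Lh * ‖e‖ ≤ Lh * (3456 * L * R ^ 3 / (8 * Lh)) := by gcongr
        _ = _ := by field_simp
    have : 0 < L * R ^ 3 := by positivity
    linarith
  have hin : inner ℝ g w = Lh * (‖e‖ ^ 2 - ‖e - w‖ ^ 2 - ‖w‖ ^ 2) / 2 := by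
    rw [hgw, inner_smul_left, norm_sub_sq_real, inner_sub_left, real_inner_self_eq_norm_sq]
    simp only [conj_trivial]
    ring
  have hsq : ‖e‖ ^ 2 < ‖e - w‖ ^ 2 := by gcongr
  have := mul_lt_mul_of_pos_left hsq hLh0
  rw [hin] at h2
  linarith

theorem StepAssumptions.of_far (h : StepAssumptions f L₁ L R) (hsvd : IsMinDirection svd)
    {z x u e g : Vec d} {ε : ℝ} (hx : ‖x - z‖ ≤ R)
    (hle : penalized (42 * L * R ^ 2) (taylorModel 3 L f z) z x ≤ f z)
    (hgdef : g = gradient (penalized (42 * L * R ^ 2) (taylorModel 3 L f z) z) x)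
    (hu : u = x - (1 / (2 * L₁ + 42 * L * R ^ 2)) • g + e)
    (he : ‖e‖ ≤ 3456 * L * R ^ 3 / (8 * (2 * L₁ + 42 * L * R ^ 2))) (hw : 3 * R ≤ ‖u - x‖) :
    f (nextPoint svd (taylorModel 3 L f z) ε (42 * L * R ^ 2) R u none)
      ≤ f z - 21 * L * R ^ 4 := by
  have hL := h.L_pos
  have hR := h.R_pos
  have hLR : 0 < L * R ^ 2 := by positivity
  have hLL := h.le_L₁
  have hL₁ : 0 < L₁ := by linarith
  have hQ := quarticOnLines_taylorModel L f z
  have hlow := le_taylorModel hL.le h.contDiff h.lip₃ z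
  have hmod := h.taylorModel_nextPoint_le hsvd z u (ε := ε)
  have hdist := norm_nextPoint_none_sub_le hR.le hsvd hQ.contDiff u (ε := ε) (α := 42 * L * R ^ 2)
  set y := nextPoint svd (taylorModel 3 L f z) ε (42 * L * R ^ 2) R u none
  set α := 42 * L * R ^ 2 with hα
  have hα0 : 0 < α := by positivity
  set w := u - x with hwd
  set Lh := 2 * L₁ + α with hLh
  have hLh0 : 0 < Lh := by positivity
  have hLh2 : Lh ≤ 2.08 * L₁ := by linarith
  have hgw : g = Lh • (e - w) := by
    rw [hwd, hu, show e - (x - (1 / Lh) • g + e - x) = (1 / Lh) • g by abel, smul_smul,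
      mul_one_div_cancel hLh0.ne', one_smul]
  have he' : ‖e‖ ≤ 3 / 8 * R := by
    refine he.trans ?_
    rw [div_le_iff₀ (by positivity)]
    have := mul_le_mul_of_nonneg_right hLL hR.le
    nlinarith [mul_pos hα0 hR]
  have hfx : f x ≤ f z := (hlow x).trans ((le_penalized hα0.le _ _ _).trans hle)
  set e' := gradient f x - g with he'd
  have hen : ‖e'‖ ≤ 0.08 * L₁ * R := by
    rw [he'd, hgdef, gradient_penalized _ (differentiable_taylorModel z),
      ← sub_sub]
    have h1 := norm_sub_le (gradient f x - gradient (taylorModel 3 L f z) x) (α • (x - z))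
    have h2 := norm_gradient_sub_le h.contDiff hL.le h.lip₃ hR hx
    rw [norm_smul, Real.norm_of_nonneg hα0.le] at h1
    have h3 : α * ‖x - z‖ ≤ α * R := by gcongr
    have h4 := mul_le_mul_of_nonneg_right hLL hR.le
    have h5 : 0 < L * R ^ 3 := by positivity
    rw [hα] at h3
    linarith
  have hgf : gradient f x = Lh • (e - w) + e' := by rw [← hgw, he'd]; abel
  set W := ‖w‖ with hW
  have hgn : ‖gradient f x‖ ≤ 2.08 * L₁ * (W + 3 / 8 * R) + 0.08 * L₁ * R := by
    rw [hgf]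
    refine (norm_add_le _ _).trans ?_
    rw [norm_smul, Real.norm_of_nonneg hLh0.le]
    have : ‖e - w‖ ≤ W + 3 / 8 * R := (norm_sub_le _ _).trans (by linarith)
    gcongr
  have hgi : inner ℝ (gradient f x) w ≤ -(2 * L₁) * W ^ 2 + 0.83 * L₁ * R * W := by
    rw [hgf, inner_add_left, inner_smul_left, inner_sub_left, real_inner_self_eq_norm_sq]
    have h1 := real_inner_le_norm e w
    have h2 := real_inner_le_norm e' w
    have h3 : ‖e‖ * W ≤ 3 / 8 * R * W := by gcongr
    have h4 : ‖e'‖ * W ≤ 0.08 * L₁ * R * W := by gcongr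
    simp only [conj_trivial]
    have h5 : inner ℝ e w - W ^ 2 ≤ -(W * (W - 3 / 8 * R)) := by nlinarith
    have h6 : 0 ≤ W * (W - 3 / 8 * R) := mul_nonneg (by positivity) (by linarith)
    have h7 : Lh * (inner ℝ e w - W ^ 2) ≤ -(2 * L₁ * (W * (W - 3 / 8 * R))) := by
      calc Lh * (inner ℝ e w - W ^ 2) ≤ Lh * -(W * (W - 3 / 8 * R)) := by gcongr
        _ ≤ _ := by nlinarith
    nlinarith
  have hgoal : 21 * L * R ^ 4 ≤ L₁ * R ^ 2 := by
    have := mul_le_mul_of_nonneg_right hLL (show 0 ≤ R ^ 2 by positivity)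
    have : 0 < L * R ^ 4 := by positivity
    linarith
  rcases le_total W (36 * R) with hW36 | hW36
  · have hfu := le_quadratic_of_hasLipschitzDerivs h.contDiff h.lip₁ x w
    rw [show x + w = u by rw [hwd]; abel] at hfu
    have hup := taylorModel_le h.contDiff h.lip₃ z u
    have hD : ‖u - z‖ ≤ 4 / 3 * W := by
      have := norm_sub_le_norm_sub_add_norm_sub u x z
      linarith
    have hD4 : L / 8 * ‖u - z‖ ^ 4 ≤ L / 8 * (4 / 3 * W) ^ 4 := by gcongr
    have h8 : L * W ^ 2 ≤ 36 ^ 2 / 576 * L₁ := by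
      have : W ^ 2 ≤ (36 * R) ^ 2 := by gcongr
      have := mul_le_mul_of_nonneg_left this hL.le
      linarith
    have h9 := mul_le_mul_of_nonneg_right h8 (show 0 ≤ W ^ 2 by positivity)
    have h10 : 0 ≤ L₁ * ((W - 3 * R) * W) :=
      mul_nonneg hL₁.le (mul_nonneg (by linarith) (by positivity))
    have h11 : 0 ≤ L₁ * ((W - 3 * R) * R) :=
      mul_nonneg hL₁.le (mul_nonneg (by linarith) hR.le)
    have h12 : 0 < L₁ * R ^ 2 := by positivity
    have := hlow y
    linarith
  · have hy := le_quadratic_of_hasLipschitzDerivs h.contDiff h.lip₁ x (w + (y - u))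
    rw [show x + (w + (y - u)) = y by rw [hwd]; abel, inner_add_right] at hy
    have h1 := (real_inner_le_norm (gradient f x) (y - u)).trans
      (mul_le_mul hgn hdist (norm_nonneg _) (by positivity))
    have h2 : ‖w + (y - u)‖ ≤ W + 12 * R := (norm_add_le _ _).trans (by linarith)
    have h3 : L₁ / 2 * ‖w + (y - u)‖ ^ 2 ≤ L₁ / 2 * (W + 12 * R) ^ 2 := by gcongr
    have h10 : 0 ≤ L₁ * ((W - 36 * R) * W) :=
      mul_nonneg hL₁.le (mul_nonneg (by linarith) (by positivity))
    have h11 : 0 ≤ L₁ * ((W - 36 * R) * R) :=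
      mul_nonneg hL₁.le (mul_nonneg (by linarith) hR.le)
    have h12 : 0 < L₁ * R ^ 2 := by positivity
    linarith

theorem StepAssumptions.of_outside_ball (h : StepAssumptions f L₁ L R)
    (hsvd : IsMinDirection svd) {z u : Vec d} {ε : ℝ} (hu : R ≤ ‖u - z‖)
    (hle : penalized (42 * L * R ^ 2) (taylorModel 3 L f z) z u ≤ f z) :
    f (nextPoint svd (taylorModel 3 L f z) ε (42 * L * R ^ 2) R u none)
      ≤ f z - 21 * L * R ^ 4 := by
  have hL := h.L_pos
  have hR := h.R_pos
  have h1 := le_taylorModel hL.le h.contDiff h.lip₃ z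
    (nextPoint svd (taylorModel 3 L f z) ε (42 * L * R ^ 2) R u none)
  have h2 := h.taylorModel_nextPoint_le hsvd z u (ε := ε)
  unfold penalized at hle
  have h3 : R ^ 2 ≤ ‖z - u‖ ^ 2 := by rw [norm_sub_rev]; gcongr
  have h4 := mul_le_mul_of_nonneg_left h3 (show 0 ≤ 42 * L * R ^ 2 / 2 by positivity)
  linarith

end

/-! ### The cutting plane method -/

theorem cuttingPlane_fst {d : ℕ} (centre : Set (Vec d) → Vec d) (h : Vec d → ℝ) (x₀ : Vec d)
    (R : ℝ) (N : ℕ) : (cuttingPlane centre h x₀ R N).1 = Metric.closedBall x₀ R ∩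
      ⋂ i : Fin (N + 1), cut (gradient h (cuttingPlane centre h x₀ R i).2)
        (cuttingPlane centre h x₀ R i).2 := by
  induction N with
  | zero => simp [cuttingPlane, Set.iInter_const]
  | succ N ih =>
    have : (cuttingPlane centre h x₀ R (N + 1)).1 = (cuttingPlane centre h x₀ R N).1 ∩
        cut (gradient h (cuttingPlane centre h x₀ R (N + 1)).2)
          (cuttingPlane centre h x₀ R (N + 1)).2 := rfl
    rw [this, ih, Set.inter_assoc]
    congr 1
    ext y
    simp only [Set.mem_inter_iff, Set.mem_iInter]
    exact (Fin.forall_fin_succ' (P := fun i : Fin (N + 1 + 1) =>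
      y ∈ cut (gradient h (cuttingPlane centre h x₀ R i).2)
        (cuttingPlane centre h x₀ R i).2)).symm

theorem IsCuttingPlaneCentre.norm_sub_le {d : ℕ} {centre : Set (Vec d) → Vec d} {τ : ℝ}
    (hc : IsCuttingPlaneCentre centre τ) {h : Vec d → ℝ} (hh : Differentiable ℝ h) (x₀ : Vec d)
    {R : ℝ} (hR : 0 < R) (t : ℕ) : ‖(cuttingPlane centre h x₀ R t).2 - x₀‖ ≤ R := by
  cases t with
  | zero => simpa [cuttingPlane] using hR.le
  | succ t =>
    have := hc.mem h hh x₀ R hR t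
    rw [cuttingPlane_fst] at this
    exact mem_closedBall_iff_norm.1 this.1

/-! ### The trust-region routine as a function -/

/-- The data of a call of the trust-region routine. -/
structure TrustRegionData (d : ℕ) where
  centre : Set (Vec d) → Vec d
  svd : Matrix (Fin d) (Fin d) ℝ → Vec d
  F : Vec d → ℝ
  z : Vec d
  ε : ℝ
  Lhat : ℝ
  α : ℝ
  R : ℝ
  N : ℕ

namespace TrustRegionData

variable {d : ℕ} (D : TrustRegionData d)

/-- The penalized objective. -/
noncomputable def hat : Vec d → ℝ := penalized D.α D.F D.z

/-- The query points of the cutting plane method. -/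
noncomputable def query (t : ℕ) : Vec d := (cuttingPlane D.centre D.hat D.z D.R t).2

/-- The final region of the cutting plane method. -/
noncomputable def region : Set (Vec d) := (cuttingPlane D.centre D.hat D.z D.R D.N).1

/-- The best query point. -/
noncomputable def best : Vec d :=
  argminFirst D.hat (D.query 0) ((List.range D.N).map fun t => D.query (t + 1))

/-- The best query point is almost stationary, so that no sampling is needed. -/
def Accepts : Prop := ‖gradient D.hat D.best‖ ≤ D.ε / 2

/-- A point of the sampling ball. -/
noncomputable def candidate (w : Vec d) : Vec d :=
  D.best - (1 / D.Lhat) • gradient D.hat D.best + (D.ε / 2 / (8 * D.Lhat)) • w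

/-- The sampling terminates. -/
def Escapes (U : ℕ → Vec d) : Prop := ∃ k, D.candidate (U k) ∉ D.region

/-- The index of the first sample outside the region (`0` if there is none). -/
noncomputable def firstEscape (U : ℕ → Vec d) : ℕ :=
  open Classical in if h : D.Escapes U then Nat.find h else 0

/-- The number of draws. -/
noncomputable def draws (U : ℕ → Vec d) : ℕ :=
  open Classical in if D.Accepts then 0 else D.firstEscape U + 1

/-- The point `u`. -/
noncomputable def sample (U : ℕ → Vec d) : Vec d :=
  open Classical in if D.Accepts then D.best else D.candidate (U (D.firstEscape U))

/-- The certificate `v`. -/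
noncomputable def certificate (u : Vec d) : Option (Vec d) :=
  open Classical in
  if D.Accepts then none
  else if ‖u - D.query 0‖ ≤ D.R then
    ((List.range (D.N + 1)).map D.query).find? fun v =>
      decide (D.hat u < D.hat v + inner ℝ (gradient D.hat v) (u - v))
  else none

/-- The next iterate. -/
noncomputable def next (U : ℕ → Vec d) : Vec d :=
  nextPoint D.svd D.F D.ε D.α D.R (D.sample U) (D.certificate (D.sample U))

theorem best_mem_and_le : (∃ t ≤ D.N, D.best = D.query t) ∧
    ∀ t ≤ D.N, D.hat D.best ≤ D.hat (D.query t) := by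
  obtain ⟨h1, h2⟩ := argminFirst_mem_and_le D.hat (D.query 0)
    ((List.range D.N).map fun t => D.query (t + 1))
  constructor
  · rcases List.mem_cons.1 h1 with h1 | h1
    · exact ⟨0, by simp, h1⟩
    · obtain ⟨t, ht, h⟩ := List.mem_map.1 h1
      exact ⟨t + 1, List.mem_range.1 ht, h.symm⟩
  · intro t ht
    refine h2 _ ?_
    cases t with
    | zero => simp
    | succ t => exact List.mem_cons_of_mem _ (List.mem_map.2 ⟨t, List.mem_range.2 ht, rfl⟩)

theorem candidate_firstEscape_notMem {U : ℕ → Vec d} (h : D.Escapes U) :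
    D.candidate (U (D.firstEscape U)) ∉ D.region := by
  classical
  unfold firstEscape
  rw [dif_pos h]
  exact Nat.find_spec h

theorem exists_certificate {u : Vec d} (hA : ¬D.Accepts) (hu : ‖u - D.z‖ ≤ D.R)
    (hS : u ∉ D.region) (hlt : D.hat u < D.hat D.best) :
    ∃ y ∈ D.certificate u, (∃ t, y = D.query t) ∧
      D.hat u < D.hat y + inner ℝ (gradient D.hat y) (u - y) := by
  classical
  have h0 : D.query 0 = D.z := rfl
  have hle := D.best_mem_and_le.2
  obtain ⟨t, ht, hcut⟩ : ∃ t ≤ D.N, u ∉ cut (gradient D.hat (D.query t)) (D.query t) := by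
    by_contra! hcon
    refine hS ?_
    unfold region
    rw [cuttingPlane_fst]
    refine ⟨mem_closedBall_iff_norm.2 hu, Set.mem_iInter.2 fun i => ?_⟩
    exact hcon i (Nat.lt_succ_iff.1 i.2)
  have hlt' : D.hat u < D.hat (D.query t)
      + inner ℝ (gradient D.hat (D.query t)) (u - D.query t) := by
    have h1 := hlt.trans_le (hle t ht)
    by_contra! hcon
    refine hcut ⟨by linarith, fun hg => ?_⟩
    rw [hg, inner_zero_left] at hcon
    linarith
  unfold certificate
  rw [if_neg hA, h0, if_pos hu]
  have hex : (((List.range (D.N + 1)).map D.query).find? fun v =>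
      decide (D.hat u < D.hat v + inner ℝ (gradient D.hat v) (u - v))).isSome := by
    rw [List.find?_isSome]
    exact ⟨D.query t, List.mem_map.2 ⟨t, List.mem_range.2 (by omega), rfl⟩, by simpa using hlt'⟩
  obtain ⟨y, hy⟩ := Option.isSome_iff_exists.1 hex
  refine ⟨y, hy, ?_, by simpa using List.find?_some hy⟩
  obtain ⟨t, -, h⟩ := List.mem_map.1 (List.mem_of_find?_eq_some hy)
  exact ⟨t, h.symm⟩

theorem certificate_eq_none {u : Vec d} (hu : D.R < ‖u - D.z‖) : D.certificate u = none := by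
  have h0 : D.query 0 = D.z := rfl
  unfold certificate
  rw [h0, if_neg (not_le.2 hu)]
  simp

end TrustRegionData

/-- One step of the trust-region method on the quartic model finds an approximately stationary
point or decreases the objective. -/
theorem StepAssumptions.next {d : ℕ} {f : Vec d → ℝ} {L₁ L R τ : ℝ}
    (h : StepAssumptions f L₁ L R) {D : TrustRegionData d} (hc : IsCuttingPlaneCentre D.centre τ)
    (hsvd : IsMinDirection D.svd) (hF : D.F = taylorModel 3 L f D.z)
    (hε : D.ε = 6912 * L * R ^ 3) (hα : D.α = 42 * L * R ^ 2)
    (hLh : D.Lhat = 2 * L₁ + 42 * L * R ^ 2) (hR : D.R = R) {U : ℕ → Vec d}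
    (hU : ∀ k, ‖U k‖ ≤ 1) (hD : D.Accepts ∨ D.Escapes U) :
    IsApproxStationary f (13824 * L * R ^ 3) (576 * L * R ^ 2) (D.next U) ∨
      f (D.next U) ≤ f D.z - 21 * L * R ^ 4 := by
  classical
  have hL0 := h.L_pos
  have hR0 := h.R_pos
  have hL₁0 : 0 < L₁ := by have := h.le_L₁; have : 0 < L * R ^ 2 := by positivity
                           linarith
  have hdiff : Differentiable ℝ D.hat := by
    unfold TrustRegionData.hat
    rw [hF]
    exact differentiable_penalized _ (differentiable_taylorModel _) _
  have hq (t : ℕ) : ‖D.query t - D.z‖ ≤ R := hR ▸ hc.norm_sub_le hdiff D.z (hR ▸ hR0) t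
  obtain ⟨⟨t, -, ht⟩, hle⟩ := D.best_mem_and_le
  have hbz : ‖D.best - D.z‖ ≤ R := ht ▸ hq t
  have hhat : D.hat = penalized (42 * L * R ^ 2) (taylorModel 3 L f D.z) D.z := by
    unfold TrustRegionData.hat; rw [hα, hF]
  have hbf : D.hat D.best ≤ f D.z := by
    refine (hle 0 (Nat.zero_le _)).trans (le_of_eq ?_)
    have : D.query 0 = D.z := rfl
    rw [this, hhat, penalized_self, taylorModel_self]
  unfold TrustRegionData.next
  rw [hF, hε, hα, hR]
  by_cases hA : D.Accepts
  · have h1 : D.sample U = D.best := if_pos hA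
    have h2 : D.certificate D.best = none := if_pos hA
    rw [h1, h2]
    unfold TrustRegionData.Accepts at hA
    rw [hε, hhat] at hA
    rw [hhat] at hbf
    exact h.of_small_gradient hsvd hbz hbf (hA.trans (by linarith))
  · have hesc := hD.resolve_left hA
    have h1 : D.sample U = D.candidate (U (D.firstEscape U)) := if_neg hA
    have hout := D.candidate_firstEscape_notMem hesc
    rw [← h1] at hout
    set u := D.sample U with hu
    set e := (D.ε / 2 / (8 * D.Lhat)) • U (D.firstEscape U) with hed
    have he : ‖e‖ ≤ 3456 * L * R ^ 3 / (8 * (2 * L₁ + 42 * L * R ^ 2)) := by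
      rw [hed, norm_smul, hε, hLh, Real.norm_of_nonneg (by positivity)]
      refine (mul_le_of_le_one_right (by positivity) (hU _)).trans (le_of_eq ?_)
      ring
    have hue : u = D.best - (1 / (2 * L₁ + 42 * L * R ^ 2)) • gradient D.hat D.best + e := by
      rw [h1, TrustRegionData.candidate, hed, hLh]
    have hg : 3456 * L * R ^ 3 < ‖gradient D.hat D.best‖ := by
      have := not_le.1 hA
      rw [hε] at this
      linarith
    have hgd : gradient D.hat D.best
        = gradient (penalized (42 * L * R ^ 2) (taylorModel 3 L f D.z) D.z) D.best := by
      rw [hhat]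
    have hbf' := hbf
    rw [hhat] at hbf'
    rcases le_total ‖u - D.best‖ (3 * R) with hw | hw
    · have hlt := h.penalized_lt hbz hgd hg hue he hw
      rcases le_or_gt ‖u - D.z‖ R with hin | hin
      · obtain ⟨y, hy, ⟨t, rfl⟩, hcert⟩ := D.exists_certificate hA (hR ▸ hin) hout
          (by rw [hhat]; exact hlt)
        rw [hhat] at hcert
        exact h.of_near hsvd hin
          ((le_penalized (by positivity) _ _ _).trans (hlt.le.trans hbf'))
          (Or.inr ⟨_, hy, hq t, hcert⟩)
      · rw [D.certificate_eq_none (hR ▸ hin)]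
        exact Or.inr (h.of_outside_ball hsvd hin.le (hlt.le.trans hbf'))
    · have hin : R < ‖u - D.z‖ := by
        have := norm_sub_le_norm_sub_add_norm_sub u D.z D.best
        rw [norm_sub_rev D.z] at this
        linarith
      rw [D.certificate_eq_none (hR ▸ hin)]
      exact Or.inr (h.of_far hsvd hbz hbf' hgd hue he hw)

/-! ### Running times -/

theorem Comp.Returns.bind {α β : Type} {x : Comp α} {g : α → Comp β} {a : α} {b : β} {s t : ℝ}
    (hx : x.Returns a s) (hg : (g a).Returns b t) : (x >>= g).Returns b (s + t) := by
  unfold Comp.Returns at *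
  subst hx
  change Option.bind (g a) _ = _
  rw [hg]
  rfl

theorem Comp.returns_pure {α : Type} (a : α) : (pure a : Comp α).Returns a 0 := rfl

theorem Comp.returns_tick (c : ℝ) : (tick c).Returns () c := rfl

theorem exploitNC_returns {d : ℕ} (T : Costs) (F : Vec d → ℝ) (c s : Vec d) (R : ℝ) :
    (exploitNC T F c s R).Returns (exploitPoint F c s R) (4 * (T.eval + T.vec) + 0) :=
  (Comp.returns_tick _).bind (Comp.returns_pure _)

theorem sampleOutside_returns {d : ℕ} (c : ℝ) (D : TrustRegionData d) {U : ℕ → Vec d}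
    (h : D.Escapes U) :
    (sampleOutside c D.region (D.best - (1 / D.Lhat) • gradient D.hat D.best)
      (D.ε / 2 / (8 * D.Lhat)) U).Returns
      (D.candidate (U (D.firstEscape U)), D.firstEscape U + 1)
      (((D.firstEscape U + 1 : ℕ) : ℝ) * c) := by
  classical
  have h1 : D.firstEscape U = Nat.find h := by
    unfold TrustRegionData.firstEscape
    exact dif_pos h
  rw [h1]
  unfold Comp.Returns sampleOutside
  exact dif_pos h

theorem Comp.Returns.ite_pos {α : Type} {c : Prop} [Decidable c] (hc : c) {x y : Comp α} {a : α}
    {t : ℝ} (hx : x.Returns a t) : (if c then x else y).Returns a t := by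
  rwa [if_pos hc]

theorem Comp.Returns.ite_neg {α : Type} {c : Prop} [Decidable c] (hc : ¬c) {x y : Comp α} {a : α}
    {t : ℝ} (hy : y.Returns a t) : (if c then x else y).Returns a t := by
  rwa [if_neg hc]

theorem nonconvexityCertificate_returns {d : ℕ} {T : Costs} (hv : 0 ≤ T.vec) (he : 0 ≤ T.eval)
    (D : TrustRegionData d) {U : ℕ → Vec d} (h : D.Accepts ∨ D.Escapes U) :
    ∃ t, (nonconvexityCertificate T D.hat D.N (cuttingPlane D.centre D.hat D.z D.R) D.Lhat
      (D.ε / 2) D.R U).Returns (D.sample U, D.certificate (D.sample U), D.draws U) t ∧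
      t ≤ T.eval + (2 * D.N + 7) * T.vec + D.draws U * ((D.N + 3) * T.vec) := by
  classical
  by_cases hA : D.Accepts
  · have h1 : D.sample U = D.best := if_pos hA
    have h2 : D.certificate D.best = none := if_pos hA
    have h3 : D.draws U = 0 := if_pos hA
    rw [h1, h2, h3]
    refine ⟨_, (Comp.returns_tick _).bind ((Comp.returns_tick _).bind
      (Comp.Returns.ite_pos hA (Comp.returns_pure _))), ?_⟩
    have : 0 ≤ D.N * T.vec := by positivity
    push_cast
    nlinarith
  · have hesc := h.resolve_left hA
    have h1 : D.sample U = D.candidate (U (D.firstEscape U)) := if_neg hA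
    have h3 : D.draws U = D.firstEscape U + 1 := if_neg hA
    by_cases hb : ‖D.sample U - D.query 0‖ ≤ D.R
    · have h2 : D.certificate (D.sample U) = ((List.range (D.N + 1)).map D.query).find? fun v =>
          decide (D.hat (D.sample U) < D.hat v
            + inner ℝ (gradient D.hat v) (D.sample U - v)) := by
        rw [TrustRegionData.certificate, if_neg hA, if_pos hb]
      rw [h1] at hb
      rw [h2, h3, h1]
      refine ⟨_, (Comp.returns_tick _).bind ((Comp.returns_tick _).bind
        (Comp.Returns.ite_neg hA ((Comp.returns_tick _).bind ((sampleOutside_returns _ D hesc).bind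
          ((Comp.returns_tick _).bind (Comp.Returns.ite_pos hb ((Comp.returns_tick _).bind
            (Comp.returns_pure _)))))))), ?_⟩
      linarith
    · have h2 : D.certificate (D.sample U) = none := by
        rw [TrustRegionData.certificate, if_neg hA, if_neg hb]
      rw [h1] at hb
      rw [h2, h3, h1]
      refine ⟨_, (Comp.returns_tick _).bind ((Comp.returns_tick _).bind
        (Comp.Returns.ite_neg hA ((Comp.returns_tick _).bind ((sampleOutside_returns _ D hesc).bind
          ((Comp.returns_tick _).bind (Comp.Returns.ite_neg hb (Comp.returns_pure _))))))), ?_⟩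
      have : 0 ≤ D.N * T.vec := by positivity
      linarith

/-- The data of the call of `cuttingTrustRegion` with the given arguments. -/
noncomputable def trustRegionData {d : ℕ} (centre : Set (Vec d) → Vec d) (τ : ℝ)
    (svd : Matrix (Fin d) (Fin d) ℝ → Vec d) (F : Vec d → ℝ) (z : Vec d) (ε L₁ L₃ R : ℝ) :
    TrustRegionData d where
  centre := centre
  svd := svd
  F := F
  z := z
  ε := ε
  Lhat := L₁ + 21 * L₃ * R ^ 2
  α := 21 * L₃ * R ^ 2
  R := R
  N := ⌈(d : ℝ) / τ * Real.log (16 * (L₁ + 21 * L₃ * R ^ 2) * R / (ε / 2))⌉₊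

theorem cuttingTrustRegion_returns {d : ℕ} {T : Costs} (hv : 0 ≤ T.vec) (he : 0 ≤ T.eval)
    (hs : 0 ≤ T.svd) {centre : Set (Vec d) → Vec d} {τ : ℝ}
    {svd : Matrix (Fin d) (Fin d) ℝ → Vec d} {F : Vec d → ℝ} {z : Vec d} {ε L₁ L₃ R : ℝ}
    {D : TrustRegionData d} (hD : D = trustRegionData centre τ svd F z ε L₁ L₃ R)
    {U : ℕ → Vec d} (h : D.Accepts ∨ D.Escapes U) :
    ∃ t, (cuttingTrustRegion T centre τ svd F z ε L₁ L₃ R U).Returns (D.next U, D.draws U) t ∧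
      t ≤ D.N * (T.centre + T.eval + 3 * T.vec) + 7 * T.eval + 13 * T.vec + T.svd
        + D.draws U * ((D.N + 3) * T.vec) := by
  classical
  obtain ⟨t, ht, hle⟩ := nonconvexityCertificate_returns hv he D h
  subst hD
  set D := trustRegionData centre τ svd F z ε L₁ L₃ R with hDd
  have hN : ⌈(d : ℝ) / τ * Real.log (16 * (L₁ + 21 * L₃ * R ^ 2) * R / (ε / 2))⌉₊ = D.N := rfl
  unfold TrustRegionData.next nextPoint
  by_cases h1 : ‖gradient D.F (D.sample U)‖ ≤ D.ε
  · rw [if_pos h1]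
    by_cases h2 : -D.α ≤ quadForm (hessian D.F (D.sample U)) (D.svd (hessian D.F (D.sample U)))
    · rw [if_pos h2]
      refine ⟨_, (Comp.returns_tick _).bind (ht.bind ((Comp.returns_tick _).bind
        (Comp.Returns.ite_pos h1 ((Comp.returns_tick _).bind
          (Comp.Returns.ite_pos h2 (Comp.returns_pure _)))))), ?_⟩
      rw [hN]
      linarith
    · rw [if_neg h2]
      refine ⟨_, (Comp.returns_tick _).bind (ht.bind ((Comp.returns_tick _).bind
        (Comp.Returns.ite_pos h1 ((Comp.returns_tick _).bind
          (Comp.Returns.ite_neg h2 ((exploitNC_returns _ _ _ _ _).bind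
            (Comp.returns_pure _))))))), ?_⟩
      rw [hN]
      linarith
  · rw [if_neg h1]
    cases hcert : D.certificate (D.sample U) with
    | none =>
      rw [hcert] at ht
      refine ⟨_, (Comp.returns_tick _).bind (ht.bind ((Comp.returns_tick _).bind
        (Comp.Returns.ite_neg h1 (Comp.returns_pure _)))), ?_⟩
      rw [hN]
      linarith
    | some v =>
      rw [hcert] at ht
      refine ⟨_, (Comp.returns_tick _).bind (ht.bind ((Comp.returns_tick _).bind
        (Comp.Returns.ite_neg h1 ((exploitNC_returns _ _ _ _ _).bind
            (Comp.returns_pure _))))), ?_⟩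
      rw [hN]
      linarith

/-! ### Measurability of one step -/

theorem Measurable.measurableSet_setOf {Ω β : Type*} [MeasurableSpace Ω] [MeasurableSpace β]
    {g : Ω → β} (hg : Measurable g) {p : β → Prop} (hp : MeasurableSet {b | p b}) :
    MeasurableSet {ω | p (g ω)} :=
  hg hp

theorem measurable_argminFirst {Ω β : Type} [MeasurableSpace Ω] [MeasurableSpace β]
    {φ : Ω → β → ℝ} (hφ : Measurable (Function.uncurry φ)) {a : Ω → β} (ha : Measurable a)
    (l : List (Ω → β)) (hl : ∀ x ∈ l, Measurable x) :
    Measurable fun ω => argminFirst (φ ω) (a ω) (l.map fun x => x ω) := by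
  classical
  induction l generalizing a with
  | nil => exact ha
  | cons x l ih =>
    have hx : Measurable x := hl x (by simp)
    have := ih (a := fun ω => if φ ω (x ω) < φ ω (a ω) then x ω else a ω)
      (Measurable.ite (measurableSet_lt (hφ.comp (measurable_id.prodMk hx))
        (hφ.comp (measurable_id.prodMk ha))) hx ha) (fun y hy => hl y (by simp [hy]))
    convert this using 2 with ω
    simp only [argminFirst, List.map_cons, List.foldl_cons]

theorem measurable_find?_elim {Ω β γ : Type} [MeasurableSpace Ω] [MeasurableSpace β]
    [MeasurableSpace γ] {p : Ω → β → Prop} [∀ ω, DecidablePred (p ω)]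
    (hp : MeasurableSet {q : Ω × β | p q.1 q.2}) {g₀ : Ω → γ} (hg₀ : Measurable g₀)
    {g : Ω → β → γ} (hg : Measurable (Function.uncurry g)) (l : List (Ω → β))
    (hl : ∀ x ∈ l, Measurable x) :
    Measurable fun ω => ((l.map fun x => x ω).find? fun v => decide (p ω v)).elim (g₀ ω) (g ω) := by
  classical
  induction l with
  | nil => exact hg₀
  | cons x l ih =>
    have hx : Measurable x := hl x (by simp)
    have h : Measurable fun ω => if p ω (x ω) then g ω (x ω)
        else ((l.map fun x => x ω).find? fun v => decide (p ω v)).elim (g₀ ω) (g ω) :=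
      Measurable.ite ((measurable_id.prodMk hx).measurableSet_setOf hp) (hg.comp (measurable_id.prodMk hx))
      (ih fun y hy => hl y (by simp [hy]))
    convert h using 2 with ω
    by_cases hpx : p ω (x ω) <;> simp [hpx]

theorem continuous_taylorModel {d : ℕ} {f : Vec d → ℝ} (hf : ContDiff ℝ 3 f) (L : ℝ) :
    Continuous (Function.uncurry (taylorModel 3 L f)) := by
  unfold taylorModel Function.uncurry
  refine Continuous.add (continuous_finsetSum _ fun k hk => ?_) (by fun_prop)
  have hk' : (k : WithTop ℕ∞) ≤ 3 := by
    have := Finset.mem_range.1 hk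
    exact_mod_cast (by omega : k ≤ 3)
  have h1 := (hf.continuous_iteratedFDeriv hk').comp (continuous_fst (X := Vec d) (Y := Vec d))
  have h2 : Continuous fun a : Vec d × Vec d => (iteratedFDeriv ℝ k f a.1) fun _ => a.2 - a.1 :=
    h1.eval (by fun_prop)
  exact h2.div_const _

theorem measurable_gradient_with_param {d : ℕ} {F : Vec d → Vec d → ℝ}
    (hF : Continuous (Function.uncurry F)) :
    Measurable fun q : Vec d × Vec d => gradient (F q.1) q.2 := by
  unfold gradient
  exact (InnerProductSpace.toDual ℝ (Vec d)).symm.continuous.measurable.comp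
    (measurable_fderiv_with_param ℝ hF)

theorem QuarticOnLines.quadForm_eq {d : ℕ} {c : ℝ} {F : Vec d → ℝ} (hF : QuarticOnLines c F)
    (x s : Vec d) :
    quadForm (hessian F x) s = F (x + s) + F (x - s) - 2 * F x - 2 * c * ‖s‖ ^ 4 := by
  obtain ⟨b, hb⟩ := hF.exists_expansion x s
  have h1 := hb 1
  have h2 := hb (-1)
  rw [one_smul] at h1
  rw [neg_smul, one_smul, ← sub_eq_add_neg] at h2
  rw [h1, h2]; ring

theorem hessian_apply_eq {d : ℕ} {F : Vec d → ℝ} (hF : ContDiff ℝ 3 F) (x : Vec d)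
    (i j : Fin d) : hessian F x i j =
      (quadForm (hessian F x) (EuclideanSpace.single i 1 + EuclideanSpace.single j 1)
        - quadForm (hessian F x) (EuclideanSpace.single i 1)
        - quadForm (hessian F x) (EuclideanSpace.single j 1)) / 2 := by
  have h : IsSymmSndFDerivAt ℝ F x :=
    hF.contDiffAt.isSymmSndFDerivAt (by simp; norm_cast)
  have := h (EuclideanSpace.single i 1) (EuclideanSpace.single j 1)
  simp only [quadForm_hessian, iteratedFDeriv_two_apply, map_add, add_apply]
  simp only [hessian, Matrix.of_apply, iteratedFDeriv_two_apply, Matrix.cons_val_zero,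
    Matrix.cons_val_one]
  linarith

theorem measurable_hessian_taylorModel {d : ℕ} {f : Vec d → ℝ} (hf : ContDiff ℝ 3 f) (L : ℝ)
    (i j : Fin d) :
    Measurable fun q : Vec d × Vec d => hessian (taylorModel 3 L f q.1) q.2 i j := by
  have hQ (z : Vec d) := quarticOnLines_taylorModel L f z
  simp only [hessian_apply_eq (hQ _).contDiff, (hQ _).quadForm_eq]
  have hc := continuous_taylorModel hf L
  have h (g : Vec d × Vec d → Vec d) (hg : Continuous g) :
      Continuous fun q : Vec d × Vec d => taylorModel 3 L f q.1 (g q) :=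
    hc.comp (continuous_fst.prodMk hg)
  have h0 := h (fun q => q.2) (by fun_prop)
  have h1 (s : Vec d) := h (fun q => q.2 + s) (by fun_prop)
  have h2 (s : Vec d) := h (fun q => q.2 - s) (by fun_prop)
  have h3 (s : Vec d) : Continuous fun q : Vec d × Vec d => taylorModel 3 L f q.1 (q.2 + s)
      + taylorModel 3 L f q.1 (q.2 - s) - 2 * taylorModel 3 L f q.1 q.2
      - 2 * (L / 12) * ‖s‖ ^ 4 :=
    (((h1 s).add (h2 s)).sub (h0.const_mul 2)).sub continuous_const
  exact ((((h3 _).sub (h3 _)).sub (h3 _)).div_const 2).measurable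

theorem measurable_quadForm {Ω : Type} [MeasurableSpace Ω] {d : ℕ}
    {A : Ω → Matrix (Fin d) (Fin d) ℝ} (hA : ∀ i j, Measurable fun ω => A ω i j)
    {s : Ω → Vec d} (hs : Measurable s) : Measurable fun ω => quadForm (A ω) (s ω) := by
  have hi (i : Fin d) : Measurable fun ω => s ω i :=
    (EuclideanSpace.proj (𝕜 := ℝ) i).continuous.measurable.comp hs
  unfold quadForm dotProduct Matrix.mulVec dotProduct
  exact Finset.measurable_sum _ fun i _ => (hi i).mul
    (Finset.measurable_sum _ fun j _ => (hA i j).mul (hi j))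

theorem measurable_exploitPoint {Ω : Type} [MeasurableSpace Ω] {d : ℕ} {F : Vec d → Vec d → ℝ}
    (hF : Measurable (Function.uncurry F)) {z c s : Ω → Vec d} (hz : Measurable z)
    (hc : Measurable c) (hs : Measurable s) (R : ℝ) :
    Measurable fun ω => exploitPoint (F (z ω)) (c ω) (s ω) R := by
  unfold exploitPoint
  refine hc.add (Measurable.fun_smul ?_ hs)
  refine measurable_argminFirst (φ := fun ω (θ : ℝ) => F (z ω) (c ω + θ • s ω)) ?_
    measurable_const [fun _ => 9 * R, fun _ => -9 * R, fun _ => -12 * R] ?_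
  · exact hF.comp ((hz.comp measurable_fst).prodMk ((hc.comp measurable_fst).add
      (measurable_snd.smul (hs.comp measurable_fst))))
  · intro x hx
    simp only [List.mem_cons, List.not_mem_nil, or_false] at hx
    rcases hx with rfl | rfl | rfl <;> exact measurable_const

theorem measurableSet_cut {Ω : Type} [MeasurableSpace Ω] {d : ℕ} {g c x : Ω → Vec d}
    (hg : Measurable g) (hc : Measurable c) (hx : Measurable x) :
    MeasurableSet {ω | x ω ∈ cut (g ω) (c ω)} := by
  have h1 : MeasurableSet {ω | inner ℝ (g ω) (x ω - c ω) ≤ 0} :=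
    measurableSet_le (hg.inner (hx.sub hc)) measurable_const
  have h2 : MeasurableSet {ω | g ω = 0} := measurableSet_eq_fun hg measurable_const
  have h3 : MeasurableSet {ω | x ω = c ω} := measurableSet_eq_fun hx hc
  convert h1.inter (h2.compl.union h3) using 1
  ext ω
  simp [cut, imp_iff_not_or]

theorem measurable_cuttingPlane {d : ℕ} {centre : Set (Vec d) → Vec d} {τ : ℝ}
    (hc : IsCuttingPlaneCentre centre τ) {h : Vec d → Vec d → ℝ}
    (hh : Continuous (Function.uncurry h)) {R : ℝ} (hR : 0 < R) (t : ℕ) :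
    Measurable fun z => (cuttingPlane centre (h z) z R t).2 := by
  have hg := measurable_gradient_with_param hh
  induction t using Nat.strong_induction_on with
  | _ t ih =>
    cases t with
    | zero => exact measurable_id
    | succ t =>
      have h1 : (fun z => (cuttingPlane centre (h z) z R (t + 1)).2)
          = fun z => centre (cuttingPlane centre (h z) z R t).1 := rfl
      rw [h1]
      simp only [cuttingPlane_fst]
      have h2 (i : Fin (t + 1)) : Measurable fun z => (cuttingPlane centre (h z) z R i).2 :=
        ih i i.2
      generalize hx : (fun (i : Fin (t + 1)) z => (cuttingPlane centre (h z) z R i).2) = x at h2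
      have hx' (i : Fin (t + 1)) (z : Vec d) : (cuttingPlane centre (h z) z R i).2 = x i z := by
        rw [← hx]
      simp only [hx'] at h2 ⊢
      have h3 : Measurable fun z => (z, fun i : Fin (t + 1) => (x i z, gradient (h z) (x i z))) :=
        measurable_id.prodMk (measurable_pi_lambda _ fun i =>
          (h2 i).prodMk (hg.comp (measurable_id.prodMk (h2 i))))
      have h4 := (hc.measurable t R hR).comp h3
      simpa only [Function.comp_def] using h4

theorem measurableSet_mem_cuttingPlane {d : ℕ} {centre : Set (Vec d) → Vec d} {τ : ℝ}
    (hc : IsCuttingPlaneCentre centre τ) {h : Vec d → Vec d → ℝ}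
    (hh : Continuous (Function.uncurry h)) {R : ℝ} (hR : 0 < R) (t : ℕ) :
    MeasurableSet {q : Vec d × Vec d | q.2 ∈ (cuttingPlane centre (h q.1) q.1 R t).1} := by
  have hg := measurable_gradient_with_param hh
  simp only [cuttingPlane_fst, Set.mem_inter_iff, Set.mem_iInter, Set.ofPred_and, Set.ofPred_forall]
  refine MeasurableSet.inter ?_ (MeasurableSet.iInter fun i => ?_)
  · simp only [mem_closedBall_iff_norm]
    exact measurableSet_le (measurable_snd.sub measurable_fst).norm measurable_const
  · have h1 := (measurable_cuttingPlane hc hh hR i).comp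
      (measurable_fst : Measurable fun q : Vec d × Vec d => q.1)
    exact measurableSet_cut (hg.comp (measurable_fst.prodMk h1)) h1 measurable_snd

/-- A family of trust-region data depending measurably on the current iterate. -/
structure MeasurableFamily {d : ℕ} (D : Vec d → TrustRegionData d) : Prop where
  exists_const : ∃ (centre : Set (Vec d) → Vec d) (τ : ℝ)
    (svd : Matrix (Fin d) (Fin d) ℝ → Vec d) (f : Vec d → ℝ) (L ε Lhat α R : ℝ) (N : ℕ),
    IsCuttingPlaneCentre centre τ ∧ IsMinDirection svd ∧ ContDiff ℝ 3 f ∧ 0 < R ∧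
    ∀ z, D z = ⟨centre, svd, taylorModel 3 L f z, z, ε, Lhat, α, R, N⟩

namespace MeasurableFamily

variable {d : ℕ} {D : Vec d → TrustRegionData d}

theorem continuous_hat (hD : MeasurableFamily D) :
    Continuous (Function.uncurry fun z => (D z).hat) := by
  obtain ⟨centre, τ, svd, f, L, ε, Lhat, α, R, N, hc, hs, hf, hR, h⟩ := hD.exists_const
  simp only [h, TrustRegionData.hat]
  unfold penalized Function.uncurry
  exact (continuous_taylorModel hf L).add (by fun_prop)

theorem measurable_query (hD : MeasurableFamily D) (t : ℕ) :
    Measurable fun z => (D z).query t := by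
  have hh := hD.continuous_hat
  obtain ⟨centre, τ, svd, f, L, ε, Lhat, α, R, N, hc, hs, hf, hR, h⟩ := hD.exists_const
  have := measurable_cuttingPlane hc hh hR t
  simpa only [TrustRegionData.query, h] using this

theorem measurableSet_region (hD : MeasurableFamily D) :
    MeasurableSet {q : Vec d × Vec d | q.2 ∈ (D q.1).region} := by
  have hh := hD.continuous_hat
  obtain ⟨centre, τ, svd, f, L, ε, Lhat, α, R, N, hc, hs, hf, hR, h⟩ := hD.exists_const
  have := measurableSet_mem_cuttingPlane hc hh hR N
  simpa only [TrustRegionData.region, h] using this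

theorem measurable_best (hD : MeasurableFamily D) : Measurable fun z => (D z).best := by
  have hq := hD.measurable_query
  have hh := hD.continuous_hat
  obtain ⟨centre, τ, svd, f, L, ε, Lhat, α, R, N, hc, hs, hf, hR, h⟩ := hD.exists_const
  have hN (z) : (D z).N = N := by rw [h]
  have := measurable_argminFirst hh.measurable (hq 0)
    ((List.range N).map fun t z => (D z).query (t + 1)) (by
      intro x hx
      obtain ⟨t, -, rfl⟩ := List.mem_map.1 hx
      exact hq (t + 1))
  convert this using 2 with z
  simp [TrustRegionData.best, hN, Function.comp_def]

theorem measurable_gradient (hD : MeasurableFamily D) :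
    Measurable fun q : Vec d × Vec d => gradient (D q.1).hat q.2 :=
  measurable_gradient_with_param hD.continuous_hat

theorem measurableSet_accepts (hD : MeasurableFamily D) : MeasurableSet {z | (D z).Accepts} := by
  have h1 : Measurable fun z => gradient (D z).hat (D z).best :=
    hD.measurable_gradient.comp (measurable_id.prodMk hD.measurable_best)
  obtain ⟨centre, τ, svd, f, L, ε, Lhat, α, R, N, hc, hs, hf, hR, h⟩ := hD.exists_const
  have hε (z) : (D z).ε = ε := by rw [h]
  simp only [TrustRegionData.Accepts, hε]
  exact measurableSet_le h1.norm measurable_const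

theorem measurable_candidate (hD : MeasurableFamily D) :
    Measurable fun q : Vec d × Vec d => (D q.1).candidate q.2 := by
  have h1 : Measurable fun z => gradient (D z).hat (D z).best :=
    hD.measurable_gradient.comp (measurable_id.prodMk hD.measurable_best)
  have h2 := hD.measurable_best
  obtain ⟨centre, τ, svd, f, L, ε, Lhat, α, R, N, hc, hs, hf, hR, h⟩ := hD.exists_const
  have hε (z) : (D z).ε = ε := by rw [h]
  have hLh (z) : (D z).Lhat = Lhat := by rw [h]
  simp only [TrustRegionData.candidate, hε, hLh]
  have m1 : Measurable fun q : Vec d × Vec d => q.1 := measurable_fst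
  have m2 : Measurable fun q : Vec d × Vec d => q.2 := measurable_snd
  exact ((h2.comp m1).sub ((h1.comp m1).const_smul (1 / Lhat))).add
    (m2.const_smul (ε / 2 / (8 * Lhat)))

theorem measurableSet_candidate_mem (hD : MeasurableFamily D) :
    MeasurableSet {q : Vec d × Vec d | (D q.1).candidate q.2 ∈ (D q.1).region} :=
  (measurable_fst.prodMk hD.measurable_candidate).measurableSet_setOf hD.measurableSet_region

theorem measurableSet_candidate_apply_mem (hD : MeasurableFamily D) (k : ℕ) :
    MeasurableSet {q : Vec d × (ℕ → Vec d) | (D q.1).candidate (q.2 k) ∈ (D q.1).region} :=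
  have h : Measurable fun q : Vec d × (ℕ → Vec d) => (q.1, q.2 k) :=
    measurable_fst.prodMk ((measurable_pi_apply k).comp measurable_snd)
  h.measurableSet_setOf hD.measurableSet_candidate_mem

theorem measurable_firstEscape (hD : MeasurableFamily D) :
    Measurable fun q : Vec d × (ℕ → Vec d) => (D q.1).firstEscape q.2 := by
  classical
  have hk := hD.measurableSet_candidate_apply_mem
  refine measurable_to_countable' fun n => ?_
  have : (fun q : Vec d × (ℕ → Vec d) => (D q.1).firstEscape q.2) ⁻¹' {n}
      = {q | ((∀ k, (D q.1).candidate (q.2 k) ∈ (D q.1).region) ∧ n = 0) ∨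
        ((D q.1).candidate (q.2 n) ∉ (D q.1).region ∧
          ∀ k, k < n → (D q.1).candidate (q.2 k) ∈ (D q.1).region)} := by
    ext q
    simp only [Set.mem_preimage, Set.mem_singleton_iff, Set.mem_ofPred_eq]
    unfold TrustRegionData.firstEscape
    by_cases h : (D q.1).Escapes q.2
    · rw [dif_pos h]
      have h' : ¬∀ k, (D q.1).candidate (q.2 k) ∈ (D q.1).region := not_forall.2 h
      refine (Nat.find_eq_iff h).trans ?_
      simp only [h', false_and, false_or, not_not]
    · rw [dif_neg h]
      have h' : ∀ k, (D q.1).candidate (q.2 k) ∈ (D q.1).region := by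
        simpa [TrustRegionData.Escapes] using h
      simp [h', eq_comm]
  rw [this]
  have h1 : MeasurableSet {q : Vec d × (ℕ → Vec d) |
      ∀ k, (D q.1).candidate (q.2 k) ∈ (D q.1).region} := by
    rw [Set.ofPred_forall]; exact MeasurableSet.iInter hk
  have h2 : MeasurableSet {q : Vec d × (ℕ → Vec d) |
      ∀ k, k < n → (D q.1).candidate (q.2 k) ∈ (D q.1).region} := by
    simp only [Set.ofPred_forall]
    exact MeasurableSet.iInter fun k => MeasurableSet.iInter fun _ => hk k
  exact (h1.inter (MeasurableSet.const _)).union ((hk n).compl.inter h2)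

theorem measurable_draws (hD : MeasurableFamily D) :
    Measurable fun q : Vec d × (ℕ → Vec d) => (D q.1).draws q.2 := by
  classical
  unfold TrustRegionData.draws
  exact Measurable.ite (measurable_fst.measurableSet_setOf hD.measurableSet_accepts) measurable_const
    (hD.measurable_firstEscape.add_const 1)

theorem measurable_sample (hD : MeasurableFamily D) :
    Measurable fun q : Vec d × (ℕ → Vec d) => (D q.1).sample q.2 := by
  classical
  unfold TrustRegionData.sample
  refine Measurable.ite (measurable_fst.measurableSet_setOf hD.measurableSet_accepts)
    (hD.measurable_best.comp measurable_fst) ?_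
  have h1 : Measurable fun q : (ℕ → Vec d) × ℕ => q.1 q.2 :=
    measurable_from_prod_countable_left fun k => measurable_pi_apply k
  have h2 : Measurable fun q : Vec d × (ℕ → Vec d) => q.2 := measurable_snd
  have h3 : Measurable fun q : Vec d × (ℕ → Vec d) => q.2 ((D q.1).firstEscape q.2) :=
    h1.comp (h2.prodMk hD.measurable_firstEscape)
  have h4 : Measurable fun q : Vec d × (ℕ → Vec d) => (q.1, q.2 ((D q.1).firstEscape q.2)) :=
    measurable_fst.prodMk h3
  have h5 := hD.measurable_candidate.comp h4
  simpa only [Function.comp_def] using h5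

theorem measurable_certificate_elim (hD : MeasurableFamily D) {γ : Type} [MeasurableSpace γ]
    {g₀ : Vec d × Vec d → γ} (hg₀ : Measurable g₀) {g : Vec d × Vec d → Vec d → γ}
    (hg : Measurable (Function.uncurry g)) :
    Measurable fun q : Vec d × Vec d => ((D q.1).certificate q.2).elim (g₀ q) (g q) := by
  classical
  have hq := hD.measurable_query
  have hh := hD.continuous_hat.measurable
  have hgr := hD.measurable_gradient
  have hA := hD.measurableSet_accepts
  obtain ⟨centre, τ, svd, f, L, ε, Lhat, α, R, N, hc, hs, hf, hR, h⟩ := hD.exists_const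
  have hN (z) : (D z).N = N := by rw [h]
  have hR' (z) : (D z).R = R := by rw [h]
  have hfind := measurable_find?_elim
    (p := fun (q : Vec d × Vec d) v =>
      (D q.1).hat q.2 < (D q.1).hat v + inner ℝ (gradient (D q.1).hat v) (q.2 - v))
    (by
      have m1 : Measurable fun q : (Vec d × Vec d) × Vec d => q.1.1 :=
        measurable_fst.comp measurable_fst
      have m2 : Measurable fun q : (Vec d × Vec d) × Vec d => q.1.2 :=
        measurable_snd.comp measurable_fst
      have m3 := m1.prodMk (measurable_snd (α := Vec d × Vec d) (β := Vec d))
      exact measurableSet_lt (hh.comp (m1.prodMk m2))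
        ((hh.comp m3).add ((hgr.comp m3).inner (m2.sub measurable_snd)))) hg₀ hg
    ((List.range (N + 1)).map fun t (q : Vec d × Vec d) => (D q.1).query t)
    (by
      intro x hx
      obtain ⟨t, -, rfl⟩ := List.mem_map.1 hx
      exact (hq t).comp measurable_fst)
  have h0 : MeasurableSet {q : Vec d × Vec d | ‖q.2 - (D q.1).query 0‖ ≤ R} :=
    measurableSet_le (measurable_snd.sub ((hq 0).comp measurable_fst)).norm measurable_const
  have hA' : MeasurableSet {q : Vec d × Vec d | (D q.1).Accepts} :=
    measurable_fst.measurableSet_setOf hA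
  have hif : Measurable fun q : Vec d × Vec d => if ‖q.2 - (D q.1).query 0‖ ≤ R then _ else g₀ q :=
    Measurable.ite h0 hfind hg₀
  have hif' : Measurable fun q : Vec d × Vec d => if (D q.1).Accepts then g₀ q else _ :=
    Measurable.ite hA' hg₀ hif
  convert hif' using 2 with q
  unfold TrustRegionData.certificate
  simp only [hN, hR', List.map_map, Function.comp_def]
  by_cases h1 : (D q.1).Accepts
  · simp [h1]
  · by_cases h2 : ‖q.2 - (D q.1).query 0‖ ≤ R <;> simp [h1, h2]

theorem measurable_next (hD : MeasurableFamily D) :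
    Measurable fun q : Vec d × (ℕ → Vec d) => (D q.1).next q.2 := by
  classical
  have hce := @hD.measurable_certificate_elim
  suffices hmain : Measurable fun q : Vec d × Vec d => nextPoint (D q.1).svd (D q.1).F (D q.1).ε
      (D q.1).α (D q.1).R q.2 ((D q.1).certificate q.2) from
    by
      have h1 : Measurable fun q : Vec d × (ℕ → Vec d) => (q.1, (D q.1).sample q.2) :=
        measurable_fst.prodMk hD.measurable_sample
      have h2 := hmain.comp h1
      simpa only [Function.comp_def, TrustRegionData.next] using h2
  obtain ⟨centre, τ, svd, f, L, ε, Lhat, α, R, N, hc, hs, hf, hR, h⟩ := hD.exists_const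
  have hF : (fun q : Vec d × Vec d => nextPoint (D q.1).svd (D q.1).F (D q.1).ε
      (D q.1).α (D q.1).R q.2 ((D q.1).certificate q.2)) = fun q =>
      if ‖gradient (taylorModel 3 L f q.1) q.2‖ ≤ ε then
        if -α ≤ quadForm (hessian (taylorModel 3 L f q.1) q.2)
          (svd (hessian (taylorModel 3 L f q.1) q.2)) then q.2
        else exploitPoint (taylorModel 3 L f q.1) q.2 (svd (hessian (taylorModel 3 L f q.1) q.2)) R
      else ((D q.1).certificate q.2).elim q.2 fun v => exploitPoint (taylorModel 3 L f q.1)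
        ((1 / 2 : ℝ) • (q.2 + v)) ((1 / ‖q.2 - v‖) • (v - q.2)) R := by
    funext q
    have e1 : (D q.1).svd = svd := by rw [h]
    have e2 : (D q.1).F = taylorModel 3 L f q.1 := by rw [h]
    have e3 : (D q.1).ε = ε := by rw [h]
    have e4 : (D q.1).α = α := by rw [h]
    have e5 : (D q.1).R = R := by rw [h]
    rw [e1, e2, e3, e4, e5]
    unfold nextPoint
    cases (D q.1).certificate q.2 <;> rfl
  rw [hF]
  have hT := continuous_taylorModel hf L
  have hH := measurable_hessian_taylorModel hf L
  have hp : Measurable fun q : Vec d × Vec d => svd (hessian (taylorModel 3 L f q.1) q.2) :=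
    hs.measurable.comp (measurable_pi_lambda (fun (q : Vec d × Vec d) i j =>
      hessian (taylorModel 3 L f q.1) q.2 i j) fun i => measurable_pi_lambda _ fun j => hH i j)
  have h1 : MeasurableSet {q : Vec d × Vec d | ‖gradient (taylorModel 3 L f q.1) q.2‖ ≤ ε} :=
    measurableSet_le (measurable_gradient_with_param hT).norm measurable_const
  have h2 : MeasurableSet {q : Vec d × Vec d | -α ≤ quadForm (hessian (taylorModel 3 L f q.1) q.2)
      (svd (hessian (taylorModel 3 L f q.1) q.2))} :=
    measurableSet_le measurable_const (measurable_quadForm hH hp)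
  have h3 : Measurable fun q : Vec d × Vec d => exploitPoint (taylorModel 3 L f q.1) q.2
      (svd (hessian (taylorModel 3 L f q.1) q.2)) R :=
    measurable_exploitPoint hT.measurable measurable_fst measurable_snd hp R
  have m1 : Measurable fun q : (Vec d × Vec d) × Vec d => q.1.1 :=
    measurable_fst.comp measurable_fst
  have m2 : Measurable fun q : (Vec d × Vec d) × Vec d => q.1.2 :=
    measurable_snd.comp measurable_fst
  have m3 : Measurable fun q : (Vec d × Vec d) × Vec d => q.2 := measurable_snd
  have m4 : Measurable fun q : (Vec d × Vec d) × Vec d => (1 / 2 : ℝ) • (q.1.2 + q.2) :=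
    (m2.add m3).const_smul (1 / 2 : ℝ)
  have m5 : Measurable fun q : (Vec d × Vec d) × Vec d =>
      (1 / ‖q.1.2 - q.2‖) • (q.2 - q.1.2) :=
    (measurable_const.div (m2.sub m3).norm).fun_smul (m3.sub m2)
  have h4 : Measurable fun q : (Vec d × Vec d) × Vec d => exploitPoint (taylorModel 3 L f q.1.1)
      ((1 / 2 : ℝ) • (q.1.2 + q.2)) ((1 / ‖q.1.2 - q.2‖) • (q.2 - q.1.2)) R :=
    measurable_exploitPoint hT.measurable m1 m4 m5 R
  have h5 := hce (g₀ := fun q => q.2) measurable_snd (g := fun q v => exploitPoint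
    (taylorModel 3 L f q.1) ((1 / 2 : ℝ) • (q.2 + v)) ((1 / ‖q.2 - v‖) • (v - q.2)) R) h4
  exact Measurable.ite h1 (Measurable.ite h2 measurable_snd h3) h5

end MeasurableFamily

open MeasureTheory ProbabilityTheory

/-! ### The sampling step -/

theorem pow_mul_le_half {d : ℕ} (hd : 0 < d) {τ A : ℝ} (hτ : 0 < τ) (hτ' : τ ≤ 1 / 2)
    (hA : 1 < A) {N : ℕ} (hN : (d : ℝ) / τ * Real.log A ≤ N) :
    (1 - τ) ^ N * (A / 2) ^ d ≤ 1 / 2 := by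
  have hA0 : 0 < A := by linarith
  have h1 : (1 - τ) ^ N ≤ (A ^ d)⁻¹ := by
    calc (1 - τ) ^ N ≤ Real.exp (-τ) ^ N := by
          gcongr
          · linarith
          · exact Real.one_sub_le_exp_neg τ
      _ = Real.exp (-(N * τ)) := by rw [← Real.exp_nat_mul]; ring_nf
      _ ≤ Real.exp (-(d * Real.log A)) := by
          refine Real.exp_le_exp.2 (neg_le_neg ?_)
          calc d * Real.log A = d / τ * Real.log A * τ := by field_simp
            _ ≤ N * τ := by gcongr
      _ = (A ^ d)⁻¹ := by
          rw [Real.exp_neg, Real.exp_nat_mul, Real.exp_log hA0]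
  calc (1 - τ) ^ N * (A / 2) ^ d ≤ (A ^ d)⁻¹ * (A / 2) ^ d := by gcongr
    _ = (1 / 2) ^ d := by
      rw [div_pow, div_pow, one_pow]; field_simp
    _ ≤ 1 / 2 := pow_le_of_le_one (by norm_num) (by norm_num) hd.ne'

theorem volume_candidate_preimage_le {d : ℕ} (hd : 0 < d) {τ : ℝ} (D : TrustRegionData d)
    (hc : IsCuttingPlaneCentre D.centre τ) (hhat : Differentiable ℝ D.hat) (hR : 0 < D.R)
    (hε : 0 < D.ε) (hL : 0 < D.Lhat) (hA : 1 < 16 * D.Lhat * D.R / (D.ε / 2))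
    (hN : (d : ℝ) / τ * Real.log (16 * D.Lhat * D.R / (D.ε / 2)) ≤ D.N) :
    volume {w | D.candidate w ∈ D.region}
      ≤ ENNReal.ofReal (1 / 2) * volume (Metric.closedBall (0 : Vec d) 1) := by
  set A := 16 * D.Lhat * D.R / (D.ε / 2) with hAdef
  obtain ⟨r, hr⟩ : ∃ r, r = D.ε / 2 / (8 * D.Lhat) := ⟨_, rfl⟩
  have hr0 : 0 < r := by rw [hr]; positivity
  have hτ := hc.tau_pos
  have hτ' := hc.tau_le
  have hN0 : 0 < D.N := by
    have h1 : 0 < (d : ℝ) / τ * Real.log A :=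
      mul_pos (div_pos (by exact_mod_cast hd) hτ) (Real.log_pos hA)
    exact_mod_cast h1.trans_le hN
  have h1 : {w | D.candidate w ∈ D.region} = (fun w => r • w) ⁻¹'
      ((fun w => (D.best - (1 / D.Lhat) • gradient D.hat D.best) + w) ⁻¹' D.region) := by
    rw [hr]; rfl
  rw [h1, Measure.addHaar_preimage_smul _ hr0.ne', measure_preimage_add]
  have h2 := hc.volume_le D.hat hhat D.z D.R hR D.N hN0
  rw [Measure.addHaar_closedBall' _ _ hR.le] at h2
  have h3 : Module.finrank ℝ (Vec d) = d := by simp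
  rw [h3] at h2 ⊢
  calc ENNReal.ofReal |(r ^ d)⁻¹| * volume D.region
      ≤ ENNReal.ofReal |(r ^ d)⁻¹| * (ENNReal.ofReal ((1 - τ) ^ D.N) *
        (ENNReal.ofReal (D.R ^ d) * volume (Metric.closedBall (0 : Vec d) 1))) := by
        gcongr; exact h2
    _ = ENNReal.ofReal ((1 - τ) ^ D.N * (A / 2) ^ d)
        * volume (Metric.closedBall (0 : Vec d) 1) := by
        rw [← mul_assoc, ← mul_assoc, ← ENNReal.ofReal_mul (by positivity),
          ← ENNReal.ofReal_mul (by have : 0 ≤ 1 - τ := by linarith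
                                   positivity)]
        congr 2
        rw [abs_of_pos (by positivity)]
        have : A / 2 = D.R / r := by rw [hAdef, hr]; field_simp; norm_num
        rw [this, div_pow]; ring
    _ ≤ _ := by
        gcongr
        exact pow_mul_le_half hd hτ hτ' hA hN

section

variable {Ω : Type*} [MeasurableSpace Ω] {P : Measure Ω} {d : ℕ}

theorem IsUniform.measure_preimage_le {X : Ω → Vec d} (hX : Measurable X)
    (hu : pdf.IsUniform X (Metric.closedBall (0 : Vec d) 1) P) {A : Set (Vec d)}
    (hA : MeasurableSet A) {c : ENNReal}
    (h : volume A ≤ c * volume (Metric.closedBall (0 : Vec d) 1)) : P (X ⁻¹' A) ≤ c := by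
  have hB0 : volume (Metric.closedBall (0 : Vec d) 1) ≠ 0 :=
    (Metric.measure_closedBall_pos _ _ one_pos).ne'
  have hB : volume (Metric.closedBall (0 : Vec d) 1) ≠ ⊤ := measure_closedBall_lt_top.ne
  unfold pdf.IsUniform at hu
  rw [← Measure.map_apply hX hA, hu, cond_apply Metric.isClosed_closedBall.measurableSet]
  calc (volume (Metric.closedBall (0 : Vec d) 1))⁻¹
        * volume (Metric.closedBall (0 : Vec d) 1 ∩ A)
      ≤ (volume (Metric.closedBall (0 : Vec d) 1))⁻¹
        * (c * volume (Metric.closedBall (0 : Vec d) 1)) := by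
        gcongr
        exact (measure_mono Set.inter_subset_right).trans h
    _ = c := by
        rw [mul_comm c, ← mul_assoc, ENNReal.inv_mul_cancel hB0 hB, one_mul]

theorem measure_forall_lt_mem_le {V : ℕ → Ω → Vec d} (hi : iIndepFun V P) {A : Set (Vec d)} (hA : MeasurableSet A) {c : ENNReal}
    (h : ∀ k, P (V k ⁻¹' A) ≤ c) (k : ℕ) : P {ω | ∀ j < k, V j ω ∈ A} ≤ c ^ k := by
  have h1 := hi.measure_inter_preimage_eq_mul (Finset.range k) (sets := fun _ => A)
    (fun _ _ => hA)
  have h2 : {ω | ∀ j < k, V j ω ∈ A} = ⋂ i ∈ Finset.range k, V i ⁻¹' A := by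
    ext ω; simp
  rw [h2, h1]
  calc ∏ i ∈ Finset.range k, P (V i ⁻¹' A) ≤ ∏ _i ∈ Finset.range k, c :=
        Finset.prod_le_prod' fun i _ => h i
    _ = c ^ k := by simp

theorem ProbabilityTheory.IndepFun.measure_le_of_forall {α β : Type*} [IsProbabilityMeasure P] [MeasurableSpace α]
    [MeasurableSpace β] {X : Ω → α} {Y : Ω → β} (hX : Measurable X) (hY : Measurable Y)
    (h : IndepFun X Y P) {E : Set (α × β)} (hE : MeasurableSet E) {c : ENNReal}
    (hc : ∀ x, P {ω | (x, Y ω) ∈ E} ≤ c) : P {ω | (X ω, Y ω) ∈ E} ≤ c := by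
  have h1 := (indepFun_iff_map_prod_eq_prod_map_map hX.aemeasurable hY.aemeasurable).1 h
  have : IsProbabilityMeasure (P.map X) := Measure.isProbabilityMeasure_map hX.aemeasurable
  have : IsProbabilityMeasure (P.map Y) := Measure.isProbabilityMeasure_map hY.aemeasurable
  have h2 : P {ω | (X ω, Y ω) ∈ E} = P.map (fun ω => (X ω, Y ω)) E :=
    (Measure.map_apply (hX.prodMk hY) hE).symm
  rw [h2, h1, Measure.prod_apply hE]
  calc ∫⁻ x, P.map Y (Prod.mk x ⁻¹' E) ∂P.map X ≤ ∫⁻ _, c ∂P.map X := by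
        refine lintegral_mono fun x => ?_
        rw [Measure.map_apply hY (measurable_prodMk_left hE)]
        exact hc x
    _ = c := by simp

theorem measure_notAccepts_forall_lt_le [IsProbabilityMeasure P] {D : Vec d → TrustRegionData d}
    (hD : MeasurableFamily D)
    (hvol : ∀ z, volume {w | (D z).candidate w ∈ (D z).region}
      ≤ ENNReal.ofReal (1 / 2) * volume (Metric.closedBall (0 : Vec d) 1))
    {X : Ω → Vec d} (hX : Measurable X) {V : ℕ → Ω → Vec d} (hV : ∀ k, Measurable (V k))
    (hu : ∀ k, pdf.IsUniform (V k) (Metric.closedBall (0 : Vec d) 1) P) (hi : iIndepFun V P)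
    (hXV : IndepFun X (fun ω k => V k ω) P) (k : ℕ) :
    P {ω | ∀ j < k, (D (X ω)).candidate (V j ω) ∈ (D (X ω)).region}
      ≤ ENNReal.ofReal (1 / 2) ^ k := by
  have hE : MeasurableSet {q : Vec d × (ℕ → Vec d) |
      ∀ j < k, (D q.1).candidate (q.2 j) ∈ (D q.1).region} := by
    simp only [Set.ofPred_forall]
    exact MeasurableSet.iInter fun j => MeasurableSet.iInter fun _ =>
      hD.measurableSet_candidate_apply_mem j
  refine hXV.measure_le_of_forall hX (measurable_pi_lambda _ hV) hE fun x => ?_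
  have hA : MeasurableSet {w | (D x).candidate w ∈ (D x).region} := by
    have h1 : Measurable fun w : Vec d => (x, w) := measurable_prodMk_left
    exact h1.measurableSet_setOf hD.measurableSet_candidate_mem
  exact measure_forall_lt_mem_le hi hA
    (fun k => IsUniform.measure_preimage_le (hV k) (hu k) hA (hvol x)) k

theorem measure_lt_draws_le {D : Vec d → TrustRegionData d} {X : Ω → Vec d}
    {V : ℕ → Ω → Vec d} {c : ENNReal} {k : ℕ}
    (h : P {ω | ∀ j < k, (D (X ω)).candidate (V j ω) ∈ (D (X ω)).region} ≤ c) :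
    P {ω | k < (D (X ω)).draws fun j => V j ω} ≤ c := by
  classical
  refine (measure_mono fun ω hω => ?_).trans h
  simp only [Set.mem_ofPred_eq] at hω ⊢
  intro j hj
  unfold TrustRegionData.draws at hω
  split_ifs at hω with hA
  · exact absurd hω (Nat.not_lt_zero _)
  · unfold TrustRegionData.firstEscape at hω
    split_ifs at hω with hE
    · by_contra hcon
      exact absurd (Nat.find_min' hE hcon) (by omega)
    · have := not_exists.1 hE j
      exact not_not.1 this

theorem ae_accepts_or_escapes {D : Vec d → TrustRegionData d} {X : Ω → Vec d}
    {V : ℕ → Ω → Vec d}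
    (h : ∀ k, P {ω | ∀ j < k, (D (X ω)).candidate (V j ω) ∈ (D (X ω)).region}
      ≤ ENNReal.ofReal (1 / 2) ^ k) :
    ∀ᵐ ω ∂P, (D (X ω)).Accepts ∨ (D (X ω)).Escapes fun j => V j ω := by
  rw [ae_iff]
  refine le_antisymm (ge_of_tendsto' (ENNReal.tendsto_pow_atTop_nhds_zero_of_lt_one
    (r := ENNReal.ofReal (1 / 2)) ?_) fun k => (measure_mono fun ω hω => ?_).trans (h k)) bot_le
  · rw [ENNReal.ofReal_lt_one]; norm_num
  · intro j _
    exact not_not.1 (not_exists.1 (not_or.1 hω).2 j)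

/-! ### Exponential moments -/

theorem exp_quarter_le : Real.exp (1 / 4) ≤ 4 / 3 := by
  have h1 : Real.exp (1 / 4) ^ 4 = Real.exp 1 := by
    rw [← Real.exp_nat_mul]; norm_num
  by_contra! h
  have h2 : (4 / 3 : ℝ) ^ 4 < Real.exp (1 / 4) ^ 4 := by gcongr
  have := Real.exp_one_lt_d9
  rw [h1] at h2
  norm_num at h2
  linarith

theorem lintegral_exp_le_two [IsProbabilityMeasure P] {K : Ω → ℕ} (hK : Measurable K)
    (h : ∀ k, P {ω | k < K ω} ≤ ENNReal.ofReal (1 / 2) ^ k) :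
    ∫⁻ ω, ENNReal.ofReal (Real.exp (K ω / 4)) ∂P ≤ 2 := by
  have hm (k : ℕ) : MeasurableSet {ω | k < K ω} := measurableSet_lt measurable_const hK
  set a : ℕ → ℝ := fun k => 1 / 3 * (4 / 3) ^ k with ha
  have ha0 (k : ℕ) : 0 ≤ a k := by rw [ha]; positivity
  have hsum (n : ℕ) : (4 / 3 : ℝ) ^ n = 1 + ∑ k ∈ Finset.range n, a k := by
    rw [ha, ← Finset.mul_sum, geom_sum_eq (by norm_num)]; ring
  have hpt (ω : Ω) : ENNReal.ofReal (Real.exp (K ω / 4))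
      ≤ 1 + ∑' k, Set.indicator {ω | k < K ω} (fun _ => ENNReal.ofReal (a k)) ω := by
    have h1 : Real.exp (K ω / 4) ≤ 1 + ∑ k ∈ Finset.range (K ω), a k := by
      rw [← hsum]
      calc Real.exp (K ω / 4) = Real.exp (1 / 4) ^ K ω := by
            rw [← Real.exp_nat_mul]; ring_nf
        _ ≤ _ := by gcongr; exact exp_quarter_le
    refine (ENNReal.ofReal_le_ofReal h1).trans ?_
    rw [ENNReal.ofReal_add zero_le_one (Finset.sum_nonneg fun k _ => ha0 k), ENNReal.ofReal_one,
      ENNReal.ofReal_sum_of_nonneg fun k _ => ha0 k]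
    gcongr
    refine le_trans (le_of_eq (Finset.sum_congr rfl fun k hk => ?_))
      (ENNReal.sum_le_tsum (Finset.range (K ω)))
    rw [Set.indicator_of_mem]
    exact Finset.mem_range.1 hk
  calc ∫⁻ ω, ENNReal.ofReal (Real.exp (K ω / 4)) ∂P
      ≤ ∫⁻ ω, 1 + ∑' k, Set.indicator {ω | k < K ω} (fun _ => ENNReal.ofReal (a k)) ω ∂P :=
        lintegral_mono hpt
    _ = 1 + ∑' k, ENNReal.ofReal (a k) * P {ω | k < K ω} := by
        rw [lintegral_add_left measurable_const, lintegral_tsum fun k =>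
          (measurable_const.indicator (hm k)).aemeasurable]
        simp only [lintegral_indicator_const (hm _), lintegral_const, measure_univ, mul_one]
    _ ≤ 1 + ∑' k : ℕ, ENNReal.ofReal (1 / 3 * (2 / 3) ^ k) := by
        gcongr with k
        calc ENNReal.ofReal (a k) * P {ω | k < K ω}
            ≤ ENNReal.ofReal (a k) * ENNReal.ofReal (1 / 2) ^ k := by gcongr; exact h k
          _ = ENNReal.ofReal (1 / 3 * (2 / 3) ^ k) := by
            rw [← ENNReal.ofReal_pow (by norm_num), ← ENNReal.ofReal_mul (ha0 k), ha]
            congr 1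
            rw [mul_assoc, ← mul_pow]; norm_num
    _ = 2 := by
        have hs : Summable fun k : ℕ => (1 / 3 : ℝ) * (2 / 3) ^ k :=
          (summable_geometric_of_lt_one (by norm_num) (by norm_num)).mul_left _
        rw [← ENNReal.ofReal_tsum_of_nonneg (fun k => by positivity) hs, tsum_mul_left,
          tsum_geometric_of_lt_one (by norm_num) (by norm_num)]
        norm_num

/-- The average of finitely many counts with geometric tails has an exponential tail. -/
theorem measure_le_average_le [IsProbabilityMeasure P] {n : ℕ} (hn : 0 < n) {K : ℕ → Ω → ℕ} (hK : ∀ t, Measurable (K t))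
    (h : ∀ t k, P {ω | k < K t ω} ≤ ENNReal.ofReal (1 / 2) ^ k) (y : ℝ) :
    P {ω | y ≤ ((∑ t ∈ Finset.range n, (K t ω : ℝ)) / n + 1) / 10}
      ≤ ENNReal.ofReal (Real.exp ((1 - y) / 10)) := by
  rcases le_total y 1 with hy | hy
  · refine prob_le_one.trans ?_
    rw [ENNReal.one_le_ofReal]
    exact Real.one_le_exp (by linarith)
  have hn' : (0 : ℝ) < n := by exact_mod_cast hn
  set G : Ω → ENNReal := fun ω => ENNReal.ofReal (1 / n)
    * ∑ t ∈ Finset.range n, ENNReal.ofReal (Real.exp (K t ω / 4)) with hG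
  have hKm (t : ℕ) : Measurable fun ω => ENNReal.ofReal (Real.exp (K t ω / 4)) :=
    (((measurable_of_countable (fun k : ℕ => (k : ℝ) / 4)).comp (hK t)).exp).ennreal_ofReal
  have hsm : Measurable fun ω => ∑ t ∈ Finset.range n, ENNReal.ofReal (Real.exp (K t ω / 4)) :=
    Finset.measurable_sum _ fun t _ => hKm t
  have hGm : Measurable G := hsm.const_mul _
  have hGi : ∫⁻ ω, G ω ∂P ≤ 2 := by
    rw [hG, lintegral_const_mul _ hsm, lintegral_finsetSum _ fun t _ => hKm t]
    calc ENNReal.ofReal (1 / n)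
          * ∑ t ∈ Finset.range n, ∫⁻ ω, ENNReal.ofReal (Real.exp (K t ω / 4)) ∂P
        ≤ ENNReal.ofReal (1 / n) * ∑ _t ∈ Finset.range n, 2 := by
          gcongr with t; exact lintegral_exp_le_two (hK t) (h t)
      _ = 2 := by
          rw [Finset.sum_const, Finset.card_range, nsmul_eq_mul, ← mul_assoc,
            ← ENNReal.ofReal_natCast n, ← ENNReal.ofReal_mul (by positivity),
            one_div_mul_cancel hn'.ne', ENNReal.ofReal_one, one_mul]
  set c : ℝ := Real.exp ((10 * y - 1) / 4) with hc
  have hc0 : 0 < c := Real.exp_pos _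
  have hsub : {ω | y ≤ ((∑ t ∈ Finset.range n, (K t ω : ℝ)) / n + 1) / 10}
      ⊆ {ω | ENNReal.ofReal c ≤ G ω} := by
    intro ω hω
    simp only [Set.mem_ofPred_eq] at hω ⊢
    rw [hG]
    simp only
    rw [← ENNReal.ofReal_sum_of_nonneg fun t _ => (Real.exp_pos _).le,
      ← ENNReal.ofReal_mul (by positivity)]
    refine ENNReal.ofReal_le_ofReal ?_
    have hJ := convexOn_exp.map_sum_le (t := Finset.range n) (w := fun _ => 1 / (n : ℝ))
      (p := fun t => (K t ω : ℝ) / 4) (fun _ _ => by positivity)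
      (by simp [hn'.ne']) (fun _ _ => Set.mem_univ _)
    simp only [smul_eq_mul, ← Finset.mul_sum, ← Finset.sum_div] at hJ
    refine le_trans ?_ hJ
    rw [hc]
    gcongr
    calc (10 * y - 1) / 4 ≤ ((∑ t ∈ Finset.range n, (K t ω : ℝ)) / n) / 4 := by linarith
      _ = _ := by ring
  refine (measure_mono hsub).trans ?_
  have hM := (mul_meas_ge_le_lintegral hGm (ENNReal.ofReal c)).trans hGi
  have hcE : ENNReal.ofReal c ≠ 0 := by simpa using hc0
  have h1 : P {ω | ENNReal.ofReal c ≤ G ω} ≤ 2 / ENNReal.ofReal c := by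
    rw [ENNReal.le_div_iff_mul_le (Or.inl hcE) (Or.inl ENNReal.ofReal_ne_top), mul_comm]
    exact hM
  refine h1.trans ?_
  rw [← ENNReal.ofReal_ofNat 2, ← ENNReal.ofReal_div_of_pos hc0]
  refine ENNReal.ofReal_le_ofReal ?_
  rw [div_le_iff₀ hc0, hc, ← Real.exp_add]
  have h2 : (1 : ℝ) ≤ (1 - y) / 10 + (10 * y - 1) / 4 := by linarith
  have h3 := Real.add_one_le_exp ((1 - y) / 10 + (10 * y - 1) / 4)
  linarith

/-! ### The random iterates -/

/-- The iterates of the method as random variables. -/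
noncomputable def randomIterate (D : Vec d → TrustRegionData d) (z₀ : Vec d)
    (U : ℕ → ℕ → Ω → Vec d) : ℕ → Ω → Vec d
  | 0, _ => z₀
  | t + 1, ω => (D (randomIterate D z₀ U t ω)).next fun k => U t k ω

variable {D : Vec d → TrustRegionData d} {U : ℕ → ℕ → Ω → Vec d}

theorem MeasurableFamily.measurable_next_comp {Ω' : Type*} [MeasurableSpace Ω']
    (hD : MeasurableFamily D) {X : Ω' → Vec d} {V : ℕ → Ω' → Vec d} (hX : Measurable X)
    (hV : ∀ k, Measurable (V k)) : Measurable fun ω => (D (X ω)).next fun k => V k ω := by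
  have h1 : Measurable fun ω => (X ω, fun k => V k ω) := hX.prodMk (measurable_pi_lambda _ hV)
  have h2 := hD.measurable_next.comp h1
  simpa only [Function.comp_def] using h2

theorem measurable_randomIterate (hD : MeasurableFamily D) (z₀ : Vec d)
    (U : ℕ → ℕ → Ω → Vec d) (t : ℕ) :
    Measurable[⨆ i ∈ {i : ℕ × ℕ | i.1 < t}, MeasurableSpace.comap (U i.1 i.2) inferInstance]
      (randomIterate D z₀ U t) := by
  induction t with
  | zero => exact @measurable_const _ _ _ _ _
  | succ t ih =>
    have h1 : Measurable[⨆ i ∈ {i : ℕ × ℕ | i.1 < t + 1},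
        MeasurableSpace.comap (U i.1 i.2) inferInstance] (randomIterate D z₀ U t) :=
      ih.mono (biSup_mono fun i hi => Nat.lt_succ_of_lt hi) le_rfl
    have h2 (k : ℕ) : Measurable[⨆ i ∈ {i : ℕ × ℕ | i.1 < t + 1},
        MeasurableSpace.comap (U i.1 i.2) inferInstance] (U t k) :=
      (comap_measurable (U t k)).mono (le_biSup
        (fun i : ℕ × ℕ => MeasurableSpace.comap (U i.1 i.2) inferInstance)
        (show ((t, k) : ℕ × ℕ) ∈ {i : ℕ × ℕ | i.1 < t + 1} from Nat.lt_succ_self t)) le_rfl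
    exact @MeasurableFamily.measurable_next_comp d D Ω (_) hD _ _ h1 h2

theorem measurable_randomIterate' (hD : MeasurableFamily D) (z₀ : Vec d)
    (hU : ∀ t k, Measurable (U t k)) (t : ℕ) : Measurable (randomIterate D z₀ U t) :=
  (measurable_randomIterate hD z₀ U t).mono
    (iSup₂_le fun i _ => (hU i.1 i.2).comap_le) le_rfl

theorem indepFun_randomIterate [IsProbabilityMeasure P] (hD : MeasurableFamily D) (z₀ : Vec d)
    (hU : ∀ t k, Measurable (U t k)) (hi : iIndepFun (fun tk : ℕ × ℕ => U tk.1 tk.2) P) (t : ℕ) :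
    IndepFun (randomIterate D z₀ U t) (fun ω k => U t k ω) P := by
  have h1 := indep_iSup_of_disjoint (fun i : ℕ × ℕ => (hU i.1 i.2).comap_le) hi.iIndep
    (S := {i : ℕ × ℕ | i.1 < t}) (T := {i : ℕ × ℕ | i.1 = t})
    (Set.disjoint_left.2 fun i (hi : i.1 < t) (hi' : i.1 = t) => by omega)
  rw [IndepFun_iff_Indep]
  refine indep_of_indep_of_le_left (indep_of_indep_of_le_right h1 ?_)
    (measurable_randomIterate hD z₀ U t).comap_le
  have h2 (k : ℕ) : Measurable[⨆ i ∈ {i : ℕ × ℕ | i.1 = t},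
      MeasurableSpace.comap (U i.1 i.2) inferInstance] (U t k) :=
    (comap_measurable (U t k)).mono (le_biSup
      (fun i : ℕ × ℕ => MeasurableSpace.comap (U i.1 i.2) inferInstance)
      (show ((t, k) : ℕ × ℕ) ∈ {i : ℕ × ℕ | i.1 = t} from rfl)) le_rfl
  exact @Measurable.comap_le _ _ (_) _ _ (@measurable_pi_lambda _ _ _ (_) _ _ h2)

theorem measure_forall_lt_randomIterate_le [IsProbabilityMeasure P] (hD : MeasurableFamily D) (z₀ : Vec d)
    (hvol : ∀ z, volume {w | (D z).candidate w ∈ (D z).region}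
      ≤ ENNReal.ofReal (1 / 2) * volume (Metric.closedBall (0 : Vec d) 1))
    (hU : ∀ t k, Measurable (U t k))
    (hu : ∀ t k, pdf.IsUniform (U t k) (Metric.closedBall (0 : Vec d) 1) P)
    (hi : iIndepFun (fun tk : ℕ × ℕ => U tk.1 tk.2) P) (t k : ℕ) :
    P {ω | ∀ j < k, (D (randomIterate D z₀ U t ω)).candidate (U t j ω)
      ∈ (D (randomIterate D z₀ U t ω)).region} ≤ ENNReal.ofReal (1 / 2) ^ k := by
  have hi' : iIndepFun (fun k => U t k) P :=
    hi.precomp (g := fun k : ℕ => (t, k)) fun a b h => (Prod.mk.inj h).2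
  exact measure_notAccepts_forall_lt_le hD hvol (measurable_randomIterate' hD z₀ hU t) (hU t)
    (hu t) hi' (indepFun_randomIterate hD z₀ hU hi t) k

end

/-! ### Parameters -/

theorem radius_spec {L ε R : ℝ} (hL : 0 < L) (hε : 0 < ε)
    (hR : R = L ^ (-(1 / 3) : ℝ) * ε ^ (1 / 3 : ℝ) / 24) :
    0 < R ∧ ε = 13824 * L * R ^ 3 ∧ L ^ (1 / 3 : ℝ) * ε ^ (2 / 3 : ℝ) = 576 * L * R ^ 2 ∧
      L ^ (1 / 3 : ℝ) * ε ^ (-(4 / 3) : ℝ) * (331776 * L * R ^ 4) = 1 := by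
  obtain ⟨a, ha⟩ : ∃ a, a = L ^ (1 / 3 : ℝ) := ⟨_, rfl⟩
  obtain ⟨b, hb⟩ : ∃ b, b = ε ^ (1 / 3 : ℝ) := ⟨_, rfl⟩
  have ha0 : 0 < a := ha ▸ Real.rpow_pos_of_pos hL _
  have hb0 : 0 < b := hb ▸ Real.rpow_pos_of_pos hε _
  have haL : L = a ^ 3 := by
    rw [ha, ← Real.rpow_natCast, ← Real.rpow_mul hL.le]; norm_num
  have hbε : ε = b ^ 3 := by
    rw [hb, ← Real.rpow_natCast, ← Real.rpow_mul hε.le]; norm_num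
  have h1 : L ^ (-(1 / 3) : ℝ) = a⁻¹ := by rw [Real.rpow_neg hL.le, ha]
  have h2 : ε ^ (2 / 3 : ℝ) = b ^ 2 := by
    rw [hb, ← Real.rpow_natCast, ← Real.rpow_mul hε.le]; norm_num
  have h3 : ε ^ (-(4 / 3) : ℝ) = (b ^ 4)⁻¹ := by
    rw [Real.rpow_neg hε.le, hb, ← Real.rpow_natCast, ← Real.rpow_mul hε.le]; norm_num
  rw [h1, ← hb] at hR
  rw [h2, h3, ← ha, hR]
  clear h1 h2 h3 hR ha hb
  subst haL hbε
  refine ⟨by positivity, ?_, ?_, ?_⟩ <;> field_simp <;> norm_num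

theorem sq_mul_le_cube {L₁ L ε : ℝ} (hL₁ : 0 < L₁) (hL : 0 < L) (hε : 0 < ε)
    (h : ε ≤ L₁ ^ (3 / 2 : ℝ) / L ^ (1 / 2 : ℝ)) : ε ^ 2 * L ≤ L₁ ^ 3 := by
  have h1 : (L₁ ^ (3 / 2 : ℝ)) ^ 2 = L₁ ^ 3 := by
    rw [← Real.rpow_natCast, ← Real.rpow_natCast, ← Real.rpow_mul hL₁.le]; norm_num
  have h2 : (L ^ (1 / 2 : ℝ)) ^ 2 = L := by
    rw [← Real.rpow_natCast, ← Real.rpow_mul hL.le]; norm_num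
  have h3 : (ε * L ^ (1 / 2 : ℝ)) ^ 2 ≤ (L₁ ^ (3 / 2 : ℝ)) ^ 2 :=
    pow_le_pow_left₀ (by positivity) ((le_div_iff₀ (by positivity)).1 h) 2
  rwa [mul_pow, h1, h2] at h3

theorem log_accuracy_le {L₁ q A : ℝ} (hq : 0 < q) (hL₁ : q ≤ L₁)
    (hA : A = 16 / 3 * (L₁ / q) + 7 / 36) :
    1 < A ∧ Real.log A ≤ 3 * logPlus ((L₁ / q) ^ 3) := by
  have hr : 1 ≤ L₁ / q := (one_le_div hq).2 hL₁
  refine ⟨by linarith, ?_⟩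
  have h1 : Real.log A ≤ Real.log (Real.exp 2 * (L₁ / q)) := by
    refine Real.log_le_log (by linarith) ?_
    have h2 : (6 : ℝ) ≤ Real.exp 2 := by
      have h3 := Real.exp_one_gt_d9
      have h4 : Real.exp 2 = Real.exp 1 ^ 2 := by rw [← Real.exp_nat_mul]; norm_num
      rw [h4]; nlinarith
    nlinarith
  rw [Real.log_mul (Real.exp_pos _).ne' (by linarith), Real.log_exp] at h1
  have h2 : 1 ≤ logPlus ((L₁ / q) ^ 3) := le_max_left _ _
  have h3 : Real.log ((L₁ / q) ^ 3) ≤ logPlus ((L₁ / q) ^ 3) := le_max_right _ _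
  rw [Real.log_pow] at h3
  push_cast at h3
  linarith

/-! ### The smallest eigenvalue -/

theorem neg_le_lambdaMin {d : ℕ} {A : Matrix (Fin d) (Fin d) ℝ} {δ : ℝ} (hδ : 0 ≤ δ)
    (h : ∀ s : Vec d, -δ * ‖s‖ ^ 2 ≤ quadForm A s) : -δ ≤ lambdaMin A := by
  unfold lambdaMin
  rcases (spectrum ℝ A).eq_empty_or_nonempty with h0 | h0
  · rw [h0, Real.sInf_empty]; linarith
  refine le_csInf h0 fun μ hμ => ?_
  rw [← Matrix.spectrum_toLin', ← Module.End.hasEigenvalue_iff_mem_spectrum] at hμ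
  obtain ⟨v, hv⟩ := hμ.exists_hasEigenvector
  have h1 := hv.apply_eq_smul
  rw [Matrix.toLin'_apply] at h1
  have h2 := h (WithLp.toLp 2 v)
  have h3 : quadForm A (WithLp.toLp 2 v) = μ * (v ⬝ᵥ v) := by
    change v ⬝ᵥ A.mulVec v = _
    rw [h1, dotProduct_smul, smul_eq_mul]
  have h4 : ‖WithLp.toLp 2 v‖ ^ 2 = v ⬝ᵥ v := by
    rw [EuclideanSpace.real_norm_sq_eq]
    simp only [dotProduct, sq]
  have h5 : 0 < v ⬝ᵥ v := by
    rw [← h4]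
    have : WithLp.toLp 2 v ≠ (0 : Vec d) := fun h6 => hv.2 (by
      have := congrArg (WithLp.ofLp) h6
      simpa using this)
    have := norm_pos_iff.2 this
    positivity
  rw [h3, h4] at h2
  exact le_of_mul_le_mul_right h2 h5

/-! ### The iterates -/

section

variable {Ω : Type*} {d : ℕ} {f : Vec d → ℝ} {D : Vec d → TrustRegionData d}
  {U : ℕ → ℕ → Ω → Vec d} {ω : Ω}

theorem quarticIterates_returns {κ T₃ TC τ ε L₁ L₃ : ℝ} (hκ : 0 < κ) (hd : 0 < d)
    {centre : Set (Vec d) → Vec d} {svd : Matrix (Fin d) (Fin d) ℝ → Vec d} (z₀ : Vec d)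
    (hD : ∀ z, D z = trustRegionData centre τ svd (taylorModel 3 L₃ f z) z (ε / 2) (2 * L₁)
      (2 * L₃) (L₃ ^ (-(1 / 3) : ℝ) * ε ^ (1 / 3 : ℝ) / 24))
    {N : ℕ} (hN : ∀ z, (D z).N = N) (hN1 : 1 ≤ N)
    (h : ∀ t, (D (randomIterate D z₀ U t ω)).Accepts ∨
      (D (randomIterate D z₀ U t ω)).Escapes fun k => U t k ω) (m : ℕ) :
    ∃ time, (quarticIterates κ T₃ TC centre τ svd f z₀ ε L₁ L₃ (fun t k => U t k ω) m).Returns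
        (randomIterate D z₀ U m ω) time ∧
      time ≤ ∑ t ∈ Finset.range m, (T₃ + N * (TC + 25 * κ * (d : ℝ) ^ 3) + 4 * κ * d * N *
        ((D (randomIterate D z₀ U t ω)).draws fun k => U t k ω : ℕ)) := by
  induction m with
  | zero => exact ⟨0, Comp.returns_pure _, by simp⟩
  | succ m ih =>
    obtain ⟨s, hs, hsle⟩ := ih
    have hκd : 0 ≤ κ * (d : ℝ) := by positivity
    have hκd3 : 0 ≤ κ * (d : ℝ) ^ 3 := by positivity
    obtain ⟨t, ht, htle⟩ := cuttingTrustRegion_returns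
      (T := { centre := TC, eval := κ * (d : ℝ) ^ 3, svd := κ * (d : ℝ) ^ 3, vec := κ * (d : ℝ) })
      hκd hκd3 hκd3 (hD (randomIterate D z₀ U m ω)) (h m)
    refine ⟨_, hs.bind ((Comp.returns_tick _).bind (ht.bind (Comp.returns_pure _))), ?_⟩
    rw [Finset.sum_range_succ]
    rw [hN] at htle
    dsimp only at htle
    generalize (D (randomIterate D z₀ U m ω)).draws (fun k => U m k ω) = K at htle ⊢
    have hN1' : (1 : ℝ) ≤ N := by exact_mod_cast hN1
    have hd1 : (1 : ℝ) ≤ d := by exact_mod_cast hd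
    have hdd : κ * (d : ℝ) ≤ κ * (d : ℝ) ^ 3 :=
      mul_le_mul_of_nonneg_left (le_self_pow₀ hd1 (by norm_num)) hκ.le
    have h1 : (N : ℝ) * (κ * d) ≤ N * (κ * (d : ℝ) ^ 3) :=
      mul_le_mul_of_nonneg_left hdd (by linarith)
    have h2 : κ * (d : ℝ) ^ 3 ≤ N * (κ * (d : ℝ) ^ 3) := le_mul_of_one_le_left hκd3 hN1'
    have h3 : (K : ℝ) * (κ * d) ≤ N * (K * (κ * d)) :=
      le_mul_of_one_le_left (by positivity) hN1'
    linarith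

theorem exists_isApproxStationary {L₁ L R τ Δ : ℝ} (hf : StepAssumptions f L₁ L R)
    (z₀ : Vec d) (hbdd : BddBelow (Set.range f)) (hΔ : f z₀ - ⨅ x, f x ≤ Δ)
    (hc : ∀ z, IsCuttingPlaneCentre (D z).centre τ) (hsvd : ∀ z, IsMinDirection (D z).svd)
    (hz : ∀ z, (D z).z = z) (hF : ∀ z, (D z).F = taylorModel 3 L f z)
    (hε : ∀ z, (D z).ε = 6912 * L * R ^ 3) (hα : ∀ z, (D z).α = 42 * L * R ^ 2)
    (hLh : ∀ z, (D z).Lhat = 2 * L₁ + 42 * L * R ^ 2) (hR : ∀ z, (D z).R = R)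
    (hU : ∀ t k, ‖U t k ω‖ ≤ 1)
    (h : ∀ t, (D (randomIterate D z₀ U t ω)).Accepts ∨
      (D (randomIterate D z₀ U t ω)).Escapes fun k => U t k ω)
    {n : ℕ} (hn : Δ < n * (21 * L * R ^ 4)) :
    ∃ m ≤ n, IsApproxStationary f (13824 * L * R ^ 3) (576 * L * R ^ 2)
      (randomIterate D z₀ U m ω) := by
  by_contra! hcon
  have key : ∀ m ≤ n, f (randomIterate D z₀ U m ω) ≤ f z₀ - m * (21 * L * R ^ 4) := by
    intro m
    induction m with
    | zero => intro _; simp [randomIterate]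
    | succ m ih =>
      intro hm
      have h1 := ih (by omega)
      have h2 := hf.next (D := D (randomIterate D z₀ U m ω)) (hc _) (hsvd _) (by rw [hF, hz])
        (hε _) (hα _) (hLh _) (hR _) (hU m) (h m)
      rcases h2 with h2 | h2
      · exact absurd h2 (hcon (m + 1) hm)
      · rw [hz] at h2
        change f ((D (randomIterate D z₀ U m ω)).next _) ≤ _
        push_cast
        linarith
  have h1 := key n le_rfl
  have h2 := ciInf_le hbdd (randomIterate D z₀ U n ω)
  linarith

end

theorem pdf.IsUniform.ae_norm_le {Ω : Type*} [MeasurableSpace Ω] {P : Measure Ω} {d : ℕ}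
    {X : Ω → Vec d} (hX : Measurable X)
    (hu : pdf.IsUniform X (Metric.closedBall (0 : Vec d) 1) P) : ∀ᵐ ω ∂P, ‖X ω‖ ≤ 1 := by
  have h1 : ∀ᵐ x ∂(P.map X), x ∈ Metric.closedBall (0 : Vec d) 1 := by
    rw [hu]
    exact ae_cond_mem Metric.isClosed_closedBall.measurableSet
  filter_upwards [ae_of_ae_map hX.aemeasurable h1] with ω hω
  simpa using hω

theorem total_time_le {κ T₃ TC Λ X K a : ℝ} {n m : ℕ} {k : ℕ → ℕ} {N : ℕ} {d time : ℝ}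
    (hκ : 0 < κ) (hd : 0 ≤ d) (hT₃ : 0 ≤ T₃) (hTC : 0 ≤ TC) (hmn : m ≤ n) (hn : 1 ≤ n)
    (hN : (N : ℝ) ≤ 4 * Λ) (ha : a = d ^ 3)
    (hK : ∑ t ∈ Finset.range n, (k t : ℝ) ≤ 10 * n * K)
    (hnX : (n : ℝ) ≤ 15800 * (X + 1))
    (htime : time ≤ ∑ t ∈ Finset.range m, (T₃ + N * (TC + 25 * κ * a) + 4 * κ * d * N * k t)) :
    time + T₃ ≤ 15800 * (4 + 160 * κ) * ((X + 1) * (T₃ + (TC + a + K * d) * Λ)) := by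
  have ha0 : 0 ≤ a := ha ▸ by positivity
  have hN0 : (0 : ℝ) ≤ N := N.cast_nonneg
  have hΛ : 0 ≤ Λ := by linarith
  have hn0 : (1 : ℝ) ≤ n := by exact_mod_cast hn
  have hK0 : 0 ≤ K := by
    have h1 : (0 : ℝ) ≤ ∑ t ∈ Finset.range n, (k t : ℝ) := Finset.sum_nonneg fun t _ => by positivity
    by_contra! h2
    nlinarith
  have h1 : time ≤ n * (T₃ + N * (TC + 25 * κ * a)) + 4 * κ * d * N * (10 * n * K) := by
    calc time ≤ _ := htime
      _ ≤ ∑ t ∈ Finset.range n, (T₃ + N * (TC + 25 * κ * a) + 4 * κ * d * N * k t) :=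
        Finset.sum_le_sum_of_subset_of_nonneg (Finset.range_subset_range.2 hmn)
          fun t _ _ => by positivity
      _ = n * (T₃ + N * (TC + 25 * κ * a))
          + 4 * κ * d * N * ∑ t ∈ Finset.range n, (k t : ℝ) := by
        rw [Finset.sum_add_distrib, ← Finset.mul_sum, Finset.sum_const, Finset.card_range, nsmul_eq_mul]
      _ ≤ _ := by gcongr
  have h2 : time + T₃ ≤ n * (2 * T₃ + 4 * Λ * (TC + 25 * κ * a) + 160 * κ * d * Λ * K) := by
    have h3 : N * (TC + 25 * κ * a) ≤ 4 * Λ * (TC + 25 * κ * a) := by gcongr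
    have h4 : N * (κ * d * K) ≤ 4 * Λ * (κ * d * K) := by gcongr
    have h5 : T₃ ≤ n * T₃ := le_mul_of_one_le_left hT₃ hn0
    have h6 := mul_le_mul_of_nonneg_left h3 (by linarith : (0 : ℝ) ≤ n)
    have h7 := mul_le_mul_of_nonneg_left h4 (by linarith : (0 : ℝ) ≤ n)
    linarith
  have h3 : 2 * T₃ + 4 * Λ * (TC + 25 * κ * a) + 160 * κ * d * Λ * K
      ≤ (4 + 160 * κ) * (T₃ + (TC + a + K * d) * Λ) := by
    have e1 : 0 ≤ κ * T₃ := by positivity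
    have e2 : 0 ≤ κ * (TC * Λ) := by positivity
    have e3 : 0 ≤ κ * (a * Λ) := by positivity
    have e4 : 0 ≤ K * d * Λ := by positivity
    have e5 : 0 ≤ a * Λ := by positivity
    linarith
  have h4 : 0 ≤ T₃ + (TC + a + K * d) * Λ := by positivity
  calc time + T₃ ≤ _ := h2
    _ ≤ n * ((4 + 160 * κ) * (T₃ + (TC + a + K * d) * Λ)) := by gcongr
    _ ≤ 15800 * (X + 1) * ((4 + 160 * κ) * (T₃ + (TC + a + K * d) * Λ)) := by gcongr
    _ = _ := by ring

theorem mainTheorem2 (κ : ℝ) (hκ : 0 < κ) :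
    ∃ C : ℝ, 0 < C ∧
      ∀ (d : ℕ) (_ : 0 < d)
        (centre : Set (Vec d) → Vec d) (τ : ℝ) (_ : IsCuttingPlaneCentre centre τ)
        (svd : Matrix (Fin d) (Fin d) ℝ → Vec d) (_ : IsMinDirection svd)
        (T₃ TC : ℝ) (_ : 0 ≤ T₃) (_ : 0 ≤ TC)
        (L₁ L₃ ε Δ : ℝ) (_ : 0 < L₁) (_ : 0 < L₃)
        (_ : 0 < ε) (_ : ε ≤ L₁ ^ (3 / 2 : ℝ) / L₃ ^ (1 / 2 : ℝ))
        (f : Vec d → ℝ) (_ : ContDiff ℝ 3 f)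
        (_ : HasLipschitzDerivs 1 L₁ f Set.univ) (_ : HasLipschitzDerivs 3 L₃ f Set.univ)
        (z₀ : Vec d) (_ : BddBelow (Set.range f)) (_ : f z₀ - ⨅ x, f x ≤ Δ)
        (Ω : Type*) (_ : MeasurableSpace Ω) (P : MeasureTheory.Measure Ω)
        (_ : MeasureTheory.IsProbabilityMeasure P)
        (U : ℕ → ℕ → Ω → Vec d) (_ : ∀ t k, Measurable (U t k))
        (_ : ∀ t k, MeasureTheory.pdf.IsUniform (U t k) (Metric.closedBall (0 : Vec d) 1) P)
        (_ : ProbabilityTheory.iIndepFun (fun tk : ℕ × ℕ => U tk.1 tk.2) P),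
        ∃ Kbar : Ω → ℝ, Measurable Kbar ∧ (∀ ω, 0 < Kbar ω) ∧
          (∀ y : ℝ, P {ω | y ≤ Kbar ω} ≤ ENNReal.ofReal (Real.exp ((1 - y) / 10))) ∧
          ∀ᵐ ω ∂P, ∃ (m : ℕ) (z : Vec d) (time : ℝ),
            (quarticIterates κ T₃ TC centre τ svd f z₀ ε L₁ L₃ (fun t k => U t k ω) m).Returns
              z time ∧
            ‖gradient f z‖ ≤ ε ∧
            -(L₃ ^ (1 / 3 : ℝ) * ε ^ (2 / 3 : ℝ)) ≤ lambdaMin (hessian f z) ∧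
            -- the time includes an evaluation of `f` and its derivatives at the final point
            time + T₃ ≤ C * timeBound d T₃ TC τ L₁ L₃ ε Δ (Kbar ω) := by
  classical
  refine ⟨15800 * (4 + 160 * κ), by positivity, ?_⟩
  intro d hd centre τ hc svd hsvd T₃ TC hT₃ hTC L₁ L₃ ε Δ hL₁ hL₃ hε hεL f hf hf1 hf3 z₀ hbdd hΔ
    Ω _ P _ U hUm hUu hUi
  obtain ⟨R, hR⟩ : ∃ R, R = L₃ ^ (-(1 / 3) : ℝ) * ε ^ (1 / 3 : ℝ) / 24 := ⟨_, rfl⟩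
  obtain ⟨hR0, hεR, hδ, hX⟩ := radius_spec hL₃ hε hR
  obtain ⟨q, hq⟩ : ∃ q, q = 576 * L₃ * R ^ 2 := ⟨_, rfl⟩
  have hq0 : 0 < q := by rw [hq]; positivity
  have hq3 : q ^ 3 = ε ^ 2 * L₃ := by rw [hq, hεR]; ring
  have hqL : q ≤ L₁ := by
    refine le_of_pow_le_pow_left₀ three_ne_zero hL₁.le ?_
    rw [hq3]; exact sq_mul_le_cube hL₁ hL₃ hε hεL
  have hstep : StepAssumptions f L₁ L₃ R := ⟨hf, hf1, hf3, hL₃, hR0, hq ▸ hqL⟩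
  set D : Vec d → TrustRegionData d := fun z => trustRegionData centre τ svd
    (taylorModel 3 L₃ f z) z (ε / 2) (2 * L₁) (2 * L₃) R with hD
  obtain ⟨A, hA⟩ : ∃ A, A = 16 * (2 * L₁ + 21 * (2 * L₃) * R ^ 2) * R / (ε / 2 / 2) := ⟨_, rfl⟩
  obtain ⟨hA1, hlogA⟩ := log_accuracy_le (A := A) hq0 hqL (by
    rw [hA, hq, hεR]; field_simp; ring)
  set N : ℕ := ⌈(d : ℝ) / τ * Real.log A⌉₊ with hN
  have hDN (z : Vec d) : (D z).N = N := by rw [hN, hA]; rfl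
  have hτ := hc.tau_pos
  have hd1 : (1 : ℝ) ≤ d := by exact_mod_cast hd
  have hdτ : 1 ≤ (d : ℝ) / τ := (one_le_div hτ).2 (by linarith [hc.tau_le])
  have hlog0 : 0 < (d : ℝ) / τ * Real.log A := mul_pos (by linarith) (Real.log_pos hA1)
  have hN1 : 1 ≤ N := Nat.ceil_pos.2 hlog0
  have hN4 : (N : ℝ) ≤ 4 * (d / τ * logPlus (L₁ ^ 3 / (ε ^ 2 * L₃))) := by
    rw [← hq3, ← div_pow]
    have h1 := (Nat.ceil_lt_add_one hlog0.le).le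
    have h2 : (1 : ℝ) ≤ logPlus ((L₁ / q) ^ 3) := le_max_left _ _
    have h3 := mul_le_mul_of_nonneg_left hlogA (by linarith : (0 : ℝ) ≤ d / τ)
    nlinarith
  have hfam : MeasurableFamily D :=
    ⟨⟨centre, τ, svd, f, L₃, _, _, _, R, _, hc, hsvd, hf, hR0, fun z => rfl⟩⟩
  have hvol (z : Vec d) : volume {w | (D z).candidate w ∈ (D z).region}
      ≤ ENNReal.ofReal (1 / 2) * volume (Metric.closedBall (0 : Vec d) 1) := by
    refine volume_candidate_preimage_le hd (D z) hc
      (differentiable_penalized _ (differentiable_taylorModel z) z) hR0 (half_pos hε)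
      (show 0 < 2 * L₁ + 21 * (2 * L₃) * R ^ 2 by positivity) (hA ▸ hA1) ?_
    rw [hDN]
    exact hA ▸ Nat.le_ceil _
  have htail := measure_forall_lt_randomIterate_le hfam z₀ hvol hUm hUu hUi
  set K : ℕ → Ω → ℕ := fun t ω => (D (randomIterate D z₀ U t ω)).draws fun k => U t k ω with hK
  have hKm (t : ℕ) : Measurable (K t) := by
    have h1 := hfam.measurable_draws.comp ((measurable_randomIterate' hfam z₀ hUm t).prodMk
      (measurable_pi_lambda (fun ω k => U t k ω) (hUm t)))
    simpa only [Function.comp_def] using h1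
  have hKtail (t k : ℕ) : P {ω | k < K t ω} ≤ ENNReal.ofReal (1 / 2) ^ k :=
    measure_lt_draws_le (htail t k)
  have hc0 : 0 < 21 * L₃ * R ^ 4 := by positivity
  have hΔ0 : 0 ≤ Δ := by linarith [ciInf_le hbdd z₀]
  set n : ℕ := ⌊Δ / (21 * L₃ * R ^ 4)⌋₊ + 1 with hn
  have hnpos : 0 < n := Nat.succ_pos _
  have hnΔ : Δ < n * (21 * L₃ * R ^ 4) := by
    rw [← div_lt_iff₀ hc0, hn]; push_cast; exact Nat.lt_floor_add_one _
  have hnX : (n : ℝ) ≤ 15800 * (Δ * L₃ ^ (1 / 3 : ℝ) * ε ^ (-(4 / 3) : ℝ) + 1) := by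
    have h1 : Δ / (21 * L₃ * R ^ 4)
        = 331776 / 21 * (Δ * L₃ ^ (1 / 3 : ℝ) * ε ^ (-(4 / 3) : ℝ)) := by
      rw [div_eq_iff hc0.ne']
      linear_combination (-Δ) * hX
    have h2 : (n : ℝ) ≤ Δ / (21 * L₃ * R ^ 4) + 1 := by
      rw [hn]; push_cast; linarith [Nat.floor_le (div_nonneg hΔ0 hc0.le)]
    have h3 : 0 ≤ Δ * L₃ ^ (1 / 3 : ℝ) * ε ^ (-(4 / 3) : ℝ) := by positivity
    linarith
  have hsum (ω : Ω) : 0 ≤ ∑ t ∈ Finset.range n, (K t ω : ℝ) :=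
    Finset.sum_nonneg fun t _ => Nat.cast_nonneg _
  refine ⟨fun ω => ((∑ t ∈ Finset.range n, (K t ω : ℝ)) / n + 1) / 10, ?_, fun ω => ?_,
    measure_le_average_le hnpos hKm hKtail, ?_⟩
  · exact ((Finset.measurable_sum _ fun t _ =>
      measurable_from_nat.comp (hKm t)).div_const _ |>.add_const _).div_const _
  · have := hsum ω
    positivity
  have hacc : ∀ᵐ ω ∂P, ∀ t, (D (randomIterate D z₀ U t ω)).Accepts ∨
      (D (randomIterate D z₀ U t ω)).Escapes fun k => U t k ω :=
    ae_all_iff.2 fun t => ae_accepts_or_escapes (htail t)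
  have hball : ∀ᵐ ω ∂P, ∀ t k, ‖U t k ω‖ ≤ 1 :=
    ae_all_iff.2 fun t => ae_all_iff.2 fun k => pdf.IsUniform.ae_norm_le (hUm t k) (hUu t k)
  filter_upwards [hacc, hball] with ω hω hωU
  obtain ⟨m, hmn, hgrad, hhess⟩ := exists_isApproxStationary hstep z₀ hbdd hΔ (fun _ => hc)
    (fun _ => hsvd) (fun _ => rfl) (fun _ => rfl)
    (fun z => show ε / 2 = _ by rw [hεR]; ring)
    (fun z => show 21 * (2 * L₃) * R ^ 2 = _ by ring)
    (fun z => show 2 * L₁ + 21 * (2 * L₃) * R ^ 2 = _ by ring) (fun _ => rfl) hωU hω hnΔ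
  obtain ⟨time, htime, hle⟩ := quarticIterates_returns (T₃ := T₃) (TC := TC) hκ hd z₀
    (fun z => by rw [← hR]) hDN hN1 hω m
  refine ⟨m, _, time, htime, hεR ▸ hgrad, ?_, ?_⟩
  · rw [hδ]
    exact neg_le_lambdaMin (by positivity) hhess
  · have h1 := total_time_le (k := fun t => K t ω)
      (K := ((∑ t ∈ Finset.range n, (K t ω : ℝ)) / n + 1) / 10) hκ (by linarith : (0 : ℝ) ≤ d)
      hT₃ hTC hmn hnpos hN4 rfl (by
        have hn0 : (0 : ℝ) < n := by exact_mod_cast hnpos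
        field_simp
        linarith) hnX hle
    refine h1.trans (le_of_eq ?_)
    unfold timeBound
    ring
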